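/- **Theorem 5 (expected prediction error with uncorrelated noise).** Let $f_1,\dots,f_T:\mathbb{R}^d\to\mathbb{R}$ be random continuously differentiable loss functions (jointly distributed on a probability space, not necessarily convex), let $\mathcal{L}:\mathbb{R}^d\to\mathbb{R}$, $w^*\in\mathbb{R}^d$, $S=\operatorname{supp}(w^*)$, and for $R\in\mathbb{R}$ put $\mathcal{H}=\{w:\|w\|_1\le R,\ \operatorname{supp}(w)\subseteq S\}$. Assume, for some $B$, some $\alpha>0$ and some integer $k\ge 0$: 1. (Statistical sparsity) every $f_t(w)$ is integrable and $\mathbb{E}[f_t(w)\mid f_1,\dots,f_{t-1}]=\mathcal{L}(w)$ for all $t\le T$ and $w\in\mathbb{R}^d$; $w^*$ minimizes $\mathcal{L}$ over $\mathbb{R}^d$, $\|w^*\|_1\le R$ and $|S|\le k$. 2. (Strong convexity in expectation) $w\mapsto\mathcal{L}(w)-\frac{\alpha}{2}\sum_{i\in S}w_i^2$ is convex on $\mathbb{R}^d$. 3. (Bounded gradients) almost surely, $\|\nabla f_t(w)\|_\infty\le B$ for all $t\le T$ and $w\in\mathcal{H}$; moreover every $w\in\mathcal{H}$ has, for each $t\le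 T$, a neighbourhood on which $\|\nabla f_t\|$ is almost surely bounded by an integrable random variable (so that $\mathcal{L}$ may be differentiated under the expectation). 4. (Orthogonal noise features) $\nabla\mathcal{L}(w)_i=0$ for all $i\notin S$ and $w\in\mathcal{H}$. Let $\delta>0$, $\eta=\alpha/2$ and $\lambda=\frac{3B}{2}\sqrt{\log\left(2d\log_2(2T^3)/\delta\right)}$. Let $S_c$ denote coordinatewise soft-thresholding: $S_c(x)=0$ if $|x|<c$, and $x-c\,\operatorname{sign}(x)$ otherwise. Start from $\theta_1=0$, $\hat w_0=0$, and for $t=1,\dots,T$ set $$w_t=\frac{1}{\eta\,t(t-1)/2}\,S_{t^{3/2}\lambda}(\theta_t),\qquad \theta_{t+1}=\theta_t-t\left[\nabla f_t(w_t)-\eta w_t\right],\qquad \hat w_t=\left(1-\tfrac{2}{t+1}\right)\hat w_{t-1}+\tfrac{2}{t+1}w_t,$$ where $w_1=0$. Assume that the iterates do not leave the $\ell^1$-ball to which the assumptions refer: almost surely, for every $t\le T$, if $\operatorname{supp}(w_s)\subseteq S$ for all $s\le t$, then $\|w_t\|_1\le R$. Then, with probability at least $1-3\delta$, for all $1\le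 t\le T$, $$\mathcal{L}(\hat w_t)-\mathcal{L}(w^*)\le\frac{269\,B^2k\log\left(2d\log_2(2T^3)/\delta\right)}{\alpha t} \qquad\text{and}\qquad \frac12\|\hat w_t-w^*\|_2^2\le\frac{269\,B^2k\log\left(2d\log_2(2T^3)/\delta\right)}{\alpha^2t}.$$ -/

import Mathlib

open MeasureTheory

noncomputable section

namespace StreamingSparse

/-- Weight vectors in `ℝ^d` (with the Euclidean norm). -/
abbrev Vec (d : ℕ) : Type := EuclideanSpace ℝ (Fin d)

/-- The `ℓ¹` norm. -/
def l1norm {d : ℕ} (w : Vec d) : ℝ := ∑ i, |w i|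

/-- The set of nonzero coordinates. -/
def supp {d : ℕ} (w : Vec d) : Finset (Fin d) := Finset.univ.filter fun i => w i ≠ 0

/-- The set `ℋ` of candidate weight vectors: `‖w‖₁ ≤ R` and `supp w ⊆ S`. -/
def candidates {d : ℕ} (R : ℝ) (S : Finset (Fin d)) : Set (Vec d) :=
  {w | l1norm w ≤ R ∧ supp w ⊆ S}

/-! ### The algorithm -/

/-- Scalar soft-thresholding. -/
def softThreshold (lam x : ℝ) : ℝ := if |x| < lam then 0 else x - lam * Real.sign x

/-- Coordinatewise soft-thresholding. -/
def softThresholdVec {d : ℕ} (lam : ℝ) (x : Vec d) : Vec d :=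
  WithLp.toLp 2 fun i => softThreshold lam (x i)

/-- Sparsification step of streaming sparse regression with averaging: the weight vector `w_t`
computed from `θ_t`, with `λ_t = t^{3/2} λ`. For `ε = 0` and `t = 1` the scalar factor is `1 / 0`;
there `θ_1 = 0`, and `w_1 = 0`, the minimizer of the remaining penalty. -/
def sparsify {d : ℕ} (η lam ε : ℝ) (t : ℕ) (θ : Vec d) : Vec d :=
  (1 / (ε + η * ((t : ℝ) * ((t : ℝ) - 1) / 2))) •
    softThresholdVec ((t : ℝ) ^ (3 / 2 : ℝ) * lam) θ

/-- The state `(θ_{t+1}, ŵ_t)` of streaming sparse regression with averaging after processing the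
losses `f_1, …, f_t`. -/
def state {d : ℕ} (η lam ε : ℝ) (f : ℕ → Vec d → ℝ) : ℕ → Vec d × Vec d
  | 0 => (0, 0)
  | t + 1 =>
    let θ := (state η lam ε f t).1
    let w := sparsify η lam ε (t + 1) θ
    (θ - ((t + 1 : ℕ) : ℝ) • (gradient (f (t + 1)) w - η • w),
      (1 - 2 / (((t + 1 : ℕ) : ℝ) + 1)) • (state η lam ε f t).2
        + (2 / (((t + 1 : ℕ) : ℝ) + 1)) • w)

/-- The iterate `w_t` (for `t ≥ 1`). -/
def iterate {d : ℕ} (η lam ε : ℝ) (f : ℕ → Vec d → ℝ) (t : ℕ) : Vec d :=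
  sparsify η lam ε t (state η lam ε f (t - 1)).1

/-- The averaged iterate `ŵ_t`. -/
def average {d : ℕ} (η lam ε : ℝ) (f : ℕ → Vec d → ℝ) (t : ℕ) : Vec d :=
  (state η lam ε f t).2

/-! ### Random losses and the assumptions on them

A sequence of random losses is `f : ℕ → Ω → Vec d → ℝ`; only `f 1, …, f T` are used. -/

section Assumptions

variable {Ω : Type*} {d : ℕ}

/-- The σ-algebra generated by the random functions `f_1, …, f_{t-1}`. -/
@[reducible] def past (f : ℕ → Ω → Vec d → ℝ) (t : ℕ) : MeasurableSpace Ω :=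
  ⨆ s ∈ Set.Ico 1 t, ⨆ w : Vec d, MeasurableSpace.comap (fun ω => f s ω w) inferInstance

variable [MeasurableSpace Ω]

/-- Regularity of the random losses: they are measurable random functions, continuously
differentiable in `w`, and near every point of `ℋ` their gradients have an integrable envelope
(so that the expected loss may be differentiated under the expectation there). -/
structure RegularLosses (μ : Measure Ω) (f : ℕ → Ω → Vec d → ℝ) (T : ℕ) (R : ℝ)
    (S : Finset (Fin d)) : Prop where
  measurable : ∀ t ∈ Finset.Icc 1 T, ∀ w, Measurable fun ω => f t ω w
  contDiff : ∀ t ∈ Finset.Icc 1 T, ∀ ω, ContDiff ℝ 1 (f t ω)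
  envelope : ∀ t ∈ Finset.Icc 1 T, ∀ w ∈ candidates R S, ∃ r > 0, ∃ G : Ω → ℝ,
    Integrable G μ ∧ ∀ᵐ ω ∂μ, ∀ v ∈ Metric.ball w r, ‖gradient (f t ω) v‖ ≤ G ω

/-- Statistical sparsity: `𝔼[f_t | f_1, …, f_{t-1}] = ℒ`, and the minimizer `w*` of `ℒ` satisfies
`‖w*‖₁ ≤ R` and `supp w* = S` with `|S| ≤ k`. -/
structure StatisticalSparsity (μ : Measure Ω) (f : ℕ → Ω → Vec d → ℝ) (T : ℕ) (L : Vec d → ℝ)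
    (wstar : Vec d) (R : ℝ) (S : Finset (Fin d)) (k : ℕ) : Prop where
  integrable : ∀ t ∈ Finset.Icc 1 T, ∀ w, Integrable (fun ω => f t ω w) μ
  condExp_eq : ∀ t ∈ Finset.Icc 1 T, ∀ w,
    μ[fun ω => f t ω w | past f t] =ᵐ[μ] fun _ => L w
  minimizer : ∀ w, L wstar ≤ L w
  l1norm_le : l1norm wstar ≤ R
  supp_eq : supp wstar = S
  card_le : S.card ≤ k

/-- Strong convexity in expectation: `ℒ(w) - (α/2) ‖w[S]‖²` is convex. -/
def StronglyConvexOnSupport (L : Vec d → ℝ) (α : ℝ) (S : Finset (Fin d)) : Prop :=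
  0 < α ∧ ConvexOn ℝ Set.univ fun w : Vec d => L w - α / 2 * ∑ i ∈ S, (w i) ^ 2

/-- Bounded gradients: almost surely `‖∇f_t(w)‖_∞ ≤ B` for all `w ∈ ℋ`. -/
def BoundedGradients (μ : Measure Ω) (f : ℕ → Ω → Vec d → ℝ) (T : ℕ) (R : ℝ)
    (S : Finset (Fin d)) (B : ℝ) : Prop :=
  ∀ᵐ ω ∂μ, ∀ t ∈ Finset.Icc 1 T, ∀ w ∈ candidates R S, ∀ i, |gradient (f t ω) w i| ≤ B

/-- Orthogonal noise features: `∇ℒ(w)_i = 0` for all `i ∉ S` and all `w ∈ ℋ`. -/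
def OrthogonalNoise (L : Vec d → ℝ) (R : ℝ) (S : Finset (Fin d)) : Prop :=
  ∀ w ∈ candidates R S, ∀ i ∉ S, gradient L w i = 0

/-- The iterates of the algorithm do not leave the `ℓ¹` ball of radius `R` that the assumptions
refer to: almost surely, an iterate `w_t` is a candidate as long as the iterates up to time `t` are
supported in `S`. Nothing is assumed about the supports. -/
def IteratesInBall (μ : Measure Ω) (f : ℕ → Ω → Vec d → ℝ) (T : ℕ) (R : ℝ)
    (S : Finset (Fin d)) (η lam ε : ℝ) : Prop :=
  ∀ᵐ ω ∂μ, ∀ t ∈ Finset.Icc 1 T,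
    (∀ s ∈ Finset.Icc 1 t, supp (iterate η lam ε (fun j => f j ω) s) ⊆ S) →
      l1norm (iterate η lam ε (fun j => f j ω) t) ≤ R

end Assumptions

end StreamingSparse

end

/-!
The losses are replaced by the linearized losses with weight `t` and a quadratic term of strength
`η = α / 2`. The iterates are then the leaders for these losses with the growing penalty
`t ^ (3 / 2) λ ‖·‖₁`, and the problem separates into coordinates. In one coordinate
(`coordinate_regret_le`) each round costs a stability term `g ^ 2 / η` and the increase of the
penalty times `|u| - |w_t|`; this increase is of order `√t λ |w_t - u|` and is absorbed into a
quadratic term `t (w_t - u) ^ 2`, so that only the coordinates in `S` pay, each a constant per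
round. Strong convexity in expectation supplies `(α / 2) t ‖w_t - w*‖ ^ 2`, of which `α / 8`
remains (`sum_excess_loss_le`).

Randomness enters twice. Off the support, as long as all previous iterates are supported in `S`,
the coordinates of `θ_t` are martingales with increments bounded by `s B`, because the noise
features are orthogonal to the expected gradient; they stay below the threshold `t ^ (3 / 2) λ` at
all times (`exists_support_event`), so no coordinate off `S` is ever activated and every iterate
is a candidate. On the support, the deviation of the gradients from their expectation in the
direction `w_t - w*` is a martingale whose increments are bounded by a multiple of
`√k B t ‖w_t - w*‖`, and its fluctuations are absorbed by the remaining quadratic term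
(`measure_gradient_noise_le`). Both events come from Ville's inequality for the exponential
supermartingale, applied on the dyadic epochs of `t` (`measure_exists_epoch_lt_sum_le`), whose
number is at most `log₂ (2 T ^ 3)`. That the gradient at the random point `w_t` has the expected
gradient as its conditional expectation is `condExp_gradient_apply`.

The weighted excess losses then sum to `O(t)`, the averaging weights have total `t (t + 1) / 2`,
and convexity of `ℒ` gives the rate `1 / t`. Strong convexity at the minimizer turns the bound on
the loss into the bound on the distance.
-/

namespace StreamingSparse

/-! ### Maximal inequalities for bounded martingale differences -/

section Martingale

variable {Ω : Type*} {m0 : MeasurableSpace Ω} {μ : Measure Ω}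

/-- Conditional Hoeffding inequality, integrated against a past-measurable weight `Y`. The bound `c`
on the increment may be random, provided it is known in advance. -/
lemma integral_mul_exp_le [IsFiniteMeasure μ] {m : MeasurableSpace Ω} (hm : m ≤ m0)
    {X c Y : Ω → ℝ} {C D : ℝ} (hX : Measurable[m0] X) (hc : Measurable[m] c)
    (hY : Measurable[m] Y) (hXc : ∀ᵐ ω ∂μ, |X ω| ≤ c ω) (hcC : ∀ᵐ ω ∂μ, c ω ≤ C)
    (hY0 : ∀ ω, 0 ≤ Y ω) (hYD : ∀ᵐ ω ∂μ, Y ω ≤ D) (hmean : μ[X | m] =ᵐ[μ] 0) (a : ℝ) :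
    Integrable (fun ω => Y ω * Real.exp (a * X ω - a ^ 2 * c ω ^ 2 / 2)) μ ∧
    ∫ ω, Y ω * Real.exp (a * X ω - a ^ 2 * c ω ^ 2 / 2) ∂μ ≤ ∫ ω, Y ω ∂μ := by
  have hc' : Measurable[m0] c := hc.mono hm le_rfl
  have hY' : Measurable[m0] Y := hY.mono hm le_rfl
  have hYint : Integrable Y μ := by
    refine Integrable.of_bound hY'.aestronglyMeasurable D ?_
    filter_upwards [hYD] with ω h
    rwa [Real.norm_eq_abs, abs_of_nonneg (hY0 ω)]
  have hXint : Integrable X μ := by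
    refine Integrable.of_bound hX.aestronglyMeasurable C ?_
    filter_upwards [hXc, hcC] with ω h h'
    exact h.trans h'
  have hint : Integrable (fun ω => Y ω * Real.exp (a * X ω - a ^ 2 * c ω ^ 2 / 2)) μ := by
    refine Integrable.of_bound (Measurable.aestronglyMeasurable (by fun_prop))
      (D * Real.exp (|a| * C)) ?_
    filter_upwards [hXc, hcC, hYD] with ω h h' h''
    rw [Real.norm_eq_abs, abs_of_nonneg (mul_nonneg (hY0 ω) (Real.exp_nonneg _))]
    refine mul_le_mul h'' (Real.exp_le_exp.2 ?_) (Real.exp_nonneg _) ((hY0 ω).trans h'')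
    have h1 : a * X ω ≤ |a| * C := (le_abs_self _).trans (by
      rw [abs_mul]; exact mul_le_mul_of_nonneg_left (h.trans h') (abs_nonneg _))
    have h2 : 0 ≤ a ^ 2 * c ω ^ 2 / 2 := by positivity
    linarith
  refine ⟨hint, ?_⟩
  set Q : Ω → ℝ := fun ω => Y ω * (Real.sinh (a * c ω) * Real.exp (-(a ^ 2 * c ω ^ 2 / 2)) / c ω)
    with hQ
  have hQm : Measurable[m] Q := by
    have h1 : Measurable[m] fun ω => Real.sinh (a * c ω) :=
      Real.measurable_sinh.comp (hc.const_mul a)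
    have h2 : Measurable[m] fun ω => Real.exp (-(a ^ 2 * c ω ^ 2 / 2)) :=
      Real.measurable_exp.comp (((hc.pow_const 2).const_mul (a ^ 2)).div_const 2).neg
    exact hY.mul ((h1.mul h2).div hc)
  have hQX : Integrable (Q * X) μ := by
    refine Integrable.of_bound ((hQm.mono hm le_rfl).mul hX).aestronglyMeasurable
      (D * Real.sinh (|a| * C)) ?_
    filter_upwards [hXc, hcC, hYD] with ω h h' h''
    have hc0 : 0 ≤ c ω := (abs_nonneg _).trans h
    have e : (Q * X) ω = Y ω * (Real.sinh (a * c ω) * (Real.exp (-(a ^ 2 * c ω ^ 2 / 2)) *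
        (X ω / c ω))) := by simp only [hQ, Pi.mul_apply]; ring
    have h1 : |Real.exp (-(a ^ 2 * c ω ^ 2 / 2)) * (X ω / c ω)| ≤ 1 := by
      rw [abs_mul, Real.abs_exp, abs_div, abs_of_nonneg hc0]
      refine mul_le_one₀ (Real.exp_le_one_iff.2 ?_) (by positivity) (div_le_one_of_le₀ h hc0)
      have : 0 ≤ a ^ 2 * c ω ^ 2 / 2 := by positivity
      linarith
    have h2 : |Real.sinh (a * c ω)| ≤ Real.sinh (|a| * C) := by
      rw [Real.abs_sinh, abs_mul, abs_of_nonneg hc0]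
      exact Real.sinh_le_sinh.2 (mul_le_mul_of_nonneg_left h' (abs_nonneg _))
    rw [e, Real.norm_eq_abs, abs_mul, abs_mul, abs_of_nonneg (hY0 ω)]
    refine mul_le_mul h'' ?_ (by positivity) ((hY0 ω).trans h'')
    calc _ ≤ Real.sinh (|a| * C) * 1 := mul_le_mul h2 h1 (abs_nonneg _) ((abs_nonneg _).trans h2)
      _ = _ := mul_one _
  have hQX0 : ∫ ω, (Q * X) ω ∂μ = 0 := by
    rw [← integral_condExp hm]
    refine integral_eq_zero_of_ae ?_
    filter_upwards [condExp_mul_of_stronglyMeasurable_left hQm.stronglyMeasurable hQX hXint, hmean]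
      with ω h1 h2
    rw [h1, Pi.mul_apply, h2]
    simp
  calc ∫ ω, Y ω * Real.exp (a * X ω - a ^ 2 * c ω ^ 2 / 2) ∂μ
      ≤ ∫ ω, (Y ω + (Q * X) ω) ∂μ := by
        refine integral_mono_ae hint (hYint.add hQX) ?_
        filter_upwards [hXc] with ω h
        have hc0 : 0 ≤ c ω := (abs_nonneg _).trans h
        have hE := Real.exp_pos (-(a ^ 2 * c ω ^ 2 / 2))
        have hle : |X ω / c ω| ≤ 1 := by
          rw [abs_div, abs_of_nonneg hc0]; exact div_le_one_of_le₀ h hc0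
        have hXeq : a * X ω = X ω / c ω * (a * c ω) := by
          rcases hc0.eq_or_lt with h0 | h0
          · have : X ω = 0 := abs_nonpos_iff.1 (h.trans h0.ge)
            simp [this]
          · field_simp
        have h1 : Real.exp (a * X ω) ≤ Real.cosh (a * c ω) + X ω / c ω * Real.sinh (a * c ω) := by
          rw [hXeq]; exact Real.exp_mul_le_cosh_add_mul_sinh hle _
        have h2 : Real.cosh (a * c ω) * Real.exp (-(a ^ 2 * c ω ^ 2 / 2)) ≤ 1 := by
          calc _ ≤ Real.exp ((a * c ω) ^ 2 / 2) * Real.exp (-(a ^ 2 * c ω ^ 2 / 2)) :=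
                mul_le_mul_of_nonneg_right (Real.cosh_le_exp_half_sq _) hE.le
            _ = 1 := by rw [← Real.exp_add, ← Real.exp_zero]; congr 1; ring
        have h3 : Real.exp (a * X ω - a ^ 2 * c ω ^ 2 / 2) ≤
            1 + X ω / c ω * Real.sinh (a * c ω) * Real.exp (-(a ^ 2 * c ω ^ 2 / 2)) := by
          rw [sub_eq_add_neg, Real.exp_add]
          nlinarith [mul_le_mul_of_nonneg_right h1 hE.le]
        calc _ ≤ Y ω * (1 + X ω / c ω * Real.sinh (a * c ω) *
              Real.exp (-(a ^ 2 * c ω ^ 2 / 2))) := mul_le_mul_of_nonneg_left h3 (hY0 ω)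
          _ = _ := by simp only [hQ, Pi.mul_apply]; ring
    _ = ∫ ω, Y ω ∂μ := by rw [integral_add hYint hQX, hQX0, add_zero]

/-- The partial sums of `y`, frozen once they exceed the level `x`. -/
noncomputable def stoppedSum (x : ℝ) (y : ℕ → ℝ) : ℕ → ℝ
  | 0 => 0
  | t + 1 => stoppedSum x y t + if stoppedSum x y t ≤ x then y t else 0

lemma lt_stoppedSum {x : ℝ} {y : ℕ → ℝ} {t n : ℕ} (htn : t ≤ n)
    (h : x < ∑ s ∈ Finset.range t, y s) : x < stoppedSum x y n := by
  have stay : ∀ r j, r ≤ j → x < stoppedSum x y r → x < stoppedSum x y j := by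
    intro r j hrj hx
    induction j, hrj using Nat.le_induction with
    | base => exact hx
    | succ j _ ih =>
      rw [stoppedSum, if_neg (not_le.2 ih), add_zero]
      exact ih
  have agree : ∀ r, (∀ s < r, stoppedSum x y s ≤ x) →
      stoppedSum x y r = ∑ s ∈ Finset.range r, y s := by
    intro r
    induction r with
    | zero => intro _; simp [stoppedSum]
    | succ r ih =>
      intro hr
      rw [stoppedSum, if_pos (hr r (Nat.lt_succ_self r)), Finset.sum_range_succ,
        ih fun s hs => hr s (Nat.lt_succ_of_lt hs)]
  by_cases hex : ∃ s < t, x < stoppedSum x y s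
  · obtain ⟨s, hs, hxs⟩ := hex
    exact stay s n (hs.le.trans htn) hxs
  · push Not at hex
    exact stay t n htn (by rw [agree t hex]; exact h)

/-- Ville's maximal inequality for the exponential supermartingale of a sequence of bounded
martingale differences. Freezing the process at the first passage above the level `x` turns the
maximum over `t ≤ n` into the value at the terminal time `n`. -/
lemma measure_exists_lt_sum_le [IsProbabilityMeasure μ] {n : ℕ} {F : ℕ → MeasurableSpace Ω}
    (hF : ∀ s ≤ n, F s ≤ m0) (hmono : Monotone F) {X c : ℕ → Ω → ℝ} {C : ℝ}
    (hX : ∀ s < n, Measurable[F (s + 1)] (X s)) (hc : ∀ s < n, Measurable[F s] (c s))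
    (hXc : ∀ s < n, ∀ᵐ ω ∂μ, |X s ω| ≤ c s ω) (hcC : ∀ s < n, ∀ᵐ ω ∂μ, c s ω ≤ C)
    (hmean : ∀ s < n, μ[X s | F s] =ᵐ[μ] 0) (a x : ℝ) :
    μ {ω | ∃ t ≤ n, x < ∑ s ∈ Finset.range t, (a * X s ω - a ^ 2 * c s ω ^ 2 / 2)} ≤
      ENNReal.ofReal (Real.exp (-x)) := by
  set Z : ℕ → Ω → ℝ := fun t ω => stoppedSum x (fun s => a * X s ω - a ^ 2 * c s ω ^ 2 / 2) t
    with hZ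
  have hZsucc : ∀ t ω, Z (t + 1) ω =
      Z t ω + if Z t ω ≤ x then a * X t ω - a ^ 2 * c t ω ^ 2 / 2 else 0 := fun t ω => rfl
  have hZm : ∀ t ≤ n, Measurable[F t] (Z t) := by
    intro t
    induction t with
    | zero => intro _; exact measurable_const
    | succ t ih =>
      intro ht
      have h1 : Measurable[F (t + 1)] (Z t) := (ih (by omega)).mono (hmono (Nat.le_succ t)) le_rfl
      have h2 : Measurable[F (t + 1)] (c t) := (hc t ht).mono (hmono (Nat.le_succ t)) le_rfl
      have h3 := hX t ht
      have h4 : MeasurableSet[F (t + 1)] {ω | Z t ω ≤ x} := h1 measurableSet_Iic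
      exact h1.add (Measurable.ite h4 ((h3.const_mul a).sub
        (((h2.pow_const 2).const_mul (a ^ 2)).div_const 2)) measurable_const)
  have hZb : ∀ t ≤ n, ∀ᵐ ω ∂μ, Z t ω ≤ t * (|a| * |C|) := by
    intro t
    induction t with
    | zero => intro _; exact .of_forall fun ω => by simp [hZ, stoppedSum]
    | succ t ih =>
      intro ht
      filter_upwards [ih (by omega), hXc t ht, hcC t ht] with ω h1 h2 h3
      have h4 : a * X t ω ≤ |a| * |C| := (le_abs_self _).trans (by
        rw [abs_mul]
        exact mul_le_mul_of_nonneg_left ((h2.trans h3).trans (le_abs_self _)) (abs_nonneg _))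
      have h5 : 0 ≤ a ^ 2 * c t ω ^ 2 / 2 := by positivity
      have h6 : 0 ≤ |a| * |C| := by positivity
      rw [hZsucc]
      push_cast
      split_ifs <;> linarith
  have hstep : ∀ t ≤ n, Integrable (fun ω => Real.exp (Z t ω)) μ ∧
      ∫ ω, Real.exp (Z t ω) ∂μ ≤ 1 := by
    intro t
    induction t with
    | zero => intro _; simp [hZ, stoppedSum]
    | succ t ih =>
      intro ht
      set I : Ω → ℝ := fun ω => if Z t ω ≤ x then 1 else 0 with hI
      have hIm : Measurable[F t] I :=
        Measurable.ite (hZm t (by omega) measurableSet_Iic) measurable_const measurable_const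
      have hI01 : ∀ ω, 0 ≤ I ω ∧ I ω ≤ 1 := fun ω => by
        simp only [hI]; split_ifs <;> norm_num
      have hXm : Measurable[m0] (X t) := (hX t ht).mono (hF _ ht) le_rfl
      have hIm0 : Measurable[m0] I := hIm.mono (hF t (by omega)) le_rfl
      have hXint : Integrable (X t) μ := by
        refine Integrable.of_bound hXm.aestronglyMeasurable C ?_
        filter_upwards [hXc t ht, hcC t ht] with ω h h'
        exact h.trans h'
      have hmean' : μ[fun ω => I ω * X t ω | F t] =ᵐ[μ] 0 := by
        have hint : Integrable (I * X t) μ := by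
          refine hXint.mono (hIm0.mul hXm).aestronglyMeasurable (.of_forall fun ω => ?_)
          rw [Pi.mul_apply, norm_mul, Real.norm_eq_abs, abs_of_nonneg (hI01 ω).1]
          exact mul_le_of_le_one_left (norm_nonneg _) (hI01 ω).2
        filter_upwards [condExp_mul_of_stronglyMeasurable_left hIm.stronglyMeasurable hint hXint,
          hmean t ht] with ω h1 h2
        refine h1.trans ?_
        rw [Pi.mul_apply, h2]
        simp
      have h := integral_mul_exp_le (μ := μ) (hF t (by omega)) (X := fun ω => I ω * X t ω)
        (c := fun ω => I ω * c t ω) (Y := fun ω => Real.exp (Z t ω)) (C := |C|)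
        (D := Real.exp (t * (|a| * |C|))) (hIm0.mul hXm) (hIm.mul (hc t ht))
        (Real.measurable_exp.comp (hZm t (by omega)))
        (by
          filter_upwards [hXc t ht] with ω h1
          rw [abs_mul, abs_of_nonneg (hI01 ω).1]
          exact mul_le_mul_of_nonneg_left h1 (hI01 ω).1)
        (by
          filter_upwards [hXc t ht, hcC t ht] with ω h1 h2
          exact (mul_le_of_le_one_left ((abs_nonneg _).trans h1) (hI01 ω).2).trans
            (h2.trans (le_abs_self _)))
        (fun ω => Real.exp_nonneg _)
        (by filter_upwards [hZb t (by omega)] with ω h1 using Real.exp_le_exp.2 h1)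
        hmean' a
      have e : (fun ω => Real.exp (Z t ω) *
          Real.exp (a * (I ω * X t ω) - a ^ 2 * (I ω * c t ω) ^ 2 / 2)) =
          fun ω => Real.exp (Z (t + 1) ω) := by
        funext ω
        rw [← Real.exp_add, hZsucc]
        simp only [hI]
        split_ifs <;> simp
      rw [e] at h
      exact ⟨h.1, h.2.trans (ih (by omega)).2⟩
  obtain ⟨hint, hle⟩ := hstep n le_rfl
  have hsub : {ω | ∃ t ≤ n, x < ∑ s ∈ Finset.range t, (a * X s ω - a ^ 2 * c s ω ^ 2 / 2)} ⊆
      {ω | Real.exp x ≤ Real.exp (Z n ω)} := by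
    rintro ω ⟨t, ht, h⟩
    exact Real.exp_le_exp.2 (lt_stoppedSum ht h).le
  refine (measure_mono hsub).trans ?_
  rw [← ofReal_measureReal]
  refine ENNReal.ofReal_le_ofReal ?_
  have := mul_meas_ge_le_integral_of_nonneg (μ := μ) (f := fun ω => Real.exp (Z n ω))
    (.of_forall fun ω => Real.exp_nonneg _) hint (Real.exp x)
  have h1 : Real.exp x * μ.real {ω | Real.exp x ≤ Real.exp (Z n ω)} ≤ 1 := this.trans hle
  rw [Real.exp_neg, ← one_div, le_div_iff₀ (Real.exp_pos x)]
  linarith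

/-- Ville's inequality with one exponent `a j` for each dyadic epoch `2 ^ j ≤ t < 2 ^ (j + 1)`. -/
lemma measure_exists_epoch_lt_sum_le [IsProbabilityMeasure μ] {n : ℕ} {F : ℕ → MeasurableSpace Ω}
    (hF : ∀ s ≤ n, F s ≤ m0) (hmono : Monotone F) {X c : ℕ → Ω → ℝ} {C : ℝ}
    (hX : ∀ s < n, Measurable[F (s + 1)] (X s)) (hc : ∀ s < n, Measurable[F s] (c s))
    (hXc : ∀ s < n, ∀ᵐ ω ∂μ, |X s ω| ≤ c s ω) (hcC : ∀ s < n, ∀ᵐ ω ∂μ, c s ω ≤ C)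
    (hmean : ∀ s < n, μ[X s | F s] =ᵐ[μ] 0) (a : ℕ → ℝ) (J : ℕ) (x : ℝ) :
    μ {ω | ∃ j < J, ∃ t ≤ n,
        x < ∑ s ∈ Finset.range t, (a j * X s ω - a j ^ 2 * c s ω ^ 2 / 2)} ≤
      ENNReal.ofReal (J * Real.exp (-x)) := by
  have e : {ω | ∃ j < J, ∃ t ≤ n,
      x < ∑ s ∈ Finset.range t, (a j * X s ω - a j ^ 2 * c s ω ^ 2 / 2)} =
      ⋃ j ∈ Finset.range J, {ω | ∃ t ≤ n,
        x < ∑ s ∈ Finset.range t, (a j * X s ω - a j ^ 2 * c s ω ^ 2 / 2)} := by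
    ext ω; simp
  rw [e]
  refine (measure_biUnion_finset_le _ _).trans ?_
  refine (Finset.sum_le_sum fun j _ =>
    measure_exists_lt_sum_le hF hmono hX hc hXc hcC hmean (a j) x).trans ?_
  rw [Finset.sum_const, Finset.card_range, nsmul_eq_mul, ENNReal.ofReal_mul (Nat.cast_nonneg J),
    ENNReal.ofReal_natCast]

end Martingale

/-! ### Uniform boundaries over dyadic epochs -/

lemma rpow_three_halves {x : ℝ} (hx : 0 ≤ x) : x ^ (3 / 2 : ℝ) = x * √x := by
  rw [show (3 / 2 : ℝ) = 1 + 1 / 2 by norm_num, Real.rpow_add' hx (by norm_num), Real.rpow_one,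
    ← Real.sqrt_eq_rpow]

lemma rpow_three_halves_sq {x : ℝ} (hx : 0 ≤ x) : (x ^ (3 / 2 : ℝ)) ^ 2 = x ^ 3 := by
  rw [rpow_three_halves hx, mul_pow, Real.sq_sqrt hx]
  ring

lemma sum_range_succ_sq_le (n : ℕ) :
    ∑ s ∈ Finset.range n, ((s : ℝ) + 1) ^ 2 ≤ ((n : ℝ) + 1) ^ 3 / 3 := by
  induction n with
  | zero => norm_num
  | succ n ih =>
    rw [Finset.sum_range_succ]
    push_cast
    nlinarith [(Nat.cast_nonneg n : (0 : ℝ) ≤ n)]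

section Epochs

variable {Ω : Type*} {m0 : MeasurableSpace Ω} {μ : Measure Ω}

/-- If the increments satisfy `|X_s| ≤ (s + 1) B`, then with high probability the partial sums stay
below the boundary `(3 B / 2) √ℓ t ^ (3 / 2)` at all times at once. -/
lemma measure_exists_boundary_lt_sum_le [IsProbabilityMeasure μ] {n : ℕ}
    {F : ℕ → MeasurableSpace Ω} (hF : ∀ s ≤ n, F s ≤ m0) (hmono : Monotone F) {X : ℕ → Ω → ℝ}
    {B ℓ : ℝ} (hB : 0 ≤ B) (hℓ : 0 < ℓ)
    (hX : ∀ s < n, Measurable[F (s + 1)] (X s))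
    (hXB : ∀ s < n, ∀ᵐ ω ∂μ, |X s ω| ≤ (s + 1) * B)
    (hmean : ∀ s < n, μ[X s | F s] =ᵐ[μ] 0) :
    μ {ω | ∃ t < n, 3 * B / 2 * √ℓ * ((t : ℝ) + 1) ^ (3 / 2 : ℝ) <
        ∑ s ∈ Finset.range t, X s ω} ≤
      ENNReal.ofReal ((Nat.log 2 n + 1 : ℕ) * Real.exp (-ℓ)) := by
  -- for `B = 0` the increments vanish, and the exponents below would be divisions by zero
  rcases hB.eq_or_lt with hB0 | hB0
  · have h0 : ∀ᵐ ω ∂μ, ∀ s < n, |X s ω| ≤ (s + 1) * B :=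
      ae_all_iff.2 fun s => Filter.eventually_imp_distrib_left.2 (hXB s)
    refine le_of_eq_of_le (measure_eq_zero_iff_ae_notMem.2 ?_) zero_le
    filter_upwards [h0] with ω h
    rintro ⟨t, ht, hlt⟩
    rw [Finset.sum_eq_zero, ← hB0] at hlt
    · simp at hlt
    · intro s hs
      have := h s ((Finset.mem_range.1 hs).trans ht)
      rw [← hB0, mul_zero] at this
      exact abs_nonpos_iff.1 this
  set p : ℕ → ℝ := fun j => ((2 : ℝ) ^ j) ^ (3 / 2 : ℝ) with hp
  refine (measure_mono ?_).trans (measure_exists_epoch_lt_sum_le hF hmono hX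
    (c := fun s _ => (s + 1) * B) (C := n * B) (fun s _ => measurable_const) hXB
    (fun s hs => .of_forall fun ω => mul_le_mul_of_nonneg_right (by exact_mod_cast hs) hB)
    hmean (fun j => √ℓ / (B * p j)) (Nat.log 2 n + 1) ℓ)
  rintro ω ⟨t, ht, hlt⟩
  refine ⟨Nat.log 2 (t + 1), Nat.lt_succ_of_le (Nat.log_mono_right ht), t, ht.le, ?_⟩
  set j := Nat.log 2 (t + 1) with hj
  have ht0 : (0 : ℝ) ≤ (t : ℝ) + 1 := by positivity
  have hlow : (2 : ℝ) ^ j ≤ (t : ℝ) + 1 := by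
    exact_mod_cast Nat.pow_log_le_self 2 (Nat.succ_ne_zero t)
  have hhigh : (t : ℝ) + 1 ≤ 2 * 2 ^ j := by
    have := (Nat.lt_pow_succ_log_self (b := 2) (by norm_num) (t + 1)).le
    rw [pow_succ, mul_comm] at this
    exact_mod_cast this
  have h2j : (0 : ℝ) < 2 ^ j := by positivity
  have hp0 : 0 < p j := by positivity
  set τ : ℝ := ((t : ℝ) + 1) ^ (3 / 2 : ℝ) with hτ
  -- the exponent is tuned to the start of the epoch; throughout it `1 ≤ r ≤ 2 ^ (3 / 2)`, and the
  -- boundary suffices as long as `r ^ 2 - 9 r + 6 ≤ 0`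
  set r : ℝ := τ / p j with hr
  have hτr : τ = r * p j := by rw [hr]; field_simp
  have hr1 : 1 ≤ r := by
    rw [hr, one_le_div hp0]
    exact Real.rpow_le_rpow h2j.le hlow (by norm_num)
  have hr2 : r ≤ 3 := by
    rw [hr, div_le_iff₀ hp0]
    refine abs_le_of_sq_le_sq' ?_ (by positivity) |>.2
    rw [mul_pow, hτ, rpow_three_halves_sq ht0, hp, rpow_three_halves_sq h2j.le]
    calc ((t : ℝ) + 1) ^ 3 ≤ (2 * 2 ^ j) ^ 3 := pow_le_pow_left₀ ht0 hhigh 3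
      _ ≤ _ := by nlinarith [pow_pos h2j 3]
  have hsum : ∑ s ∈ Finset.range t, (((s : ℝ) + 1) * B) ^ 2 ≤ B ^ 2 * (τ ^ 2 / 3) := by
    rw [hτ, rpow_three_halves_sq ht0, Finset.sum_congr rfl fun s _ => mul_pow _ _ 2,
      ← Finset.sum_mul, mul_comm]
    exact mul_le_mul_of_nonneg_left (sum_range_succ_sq_le t) (sq_nonneg B)
  set a : ℝ := √ℓ / (B * p j) with ha
  have ha0 : 0 < a := div_pos (Real.sqrt_pos.2 hℓ) (mul_pos hB0 hp0)
  have hℓs : √ℓ ^ 2 = ℓ := Real.sq_sqrt hℓ.le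
  have e1 : a * (3 * B / 2 * √ℓ * τ) = 3 / 2 * ℓ * r := by
    rw [hτr, ha]; field_simp; exact hℓs
  have e2 : a ^ 2 / 2 * (B ^ 2 * (τ ^ 2 / 3)) = ℓ * r ^ 2 / 6 := by
    rw [hτr, ha]; field_simp; rw [hℓs]; ring
  calc ℓ ≤ 3 / 2 * ℓ * r - ℓ * r ^ 2 / 6 := by
        have : 0 ≤ 3 / 2 * r - r ^ 2 / 6 - 1 := by
          nlinarith [mul_nonneg (sub_nonneg.2 hr1) (sub_nonneg.2 hr2)]
        nlinarith [mul_nonneg hℓ.le this]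
    _ < a * ∑ s ∈ Finset.range t, X s ω -
        a ^ 2 / 2 * ∑ s ∈ Finset.range t, (((s : ℝ) + 1) * B) ^ 2 := by
        have h1 := mul_lt_mul_of_pos_left hlt ha0
        have h2 := mul_le_mul_of_nonneg_left hsum (by positivity : 0 ≤ a ^ 2 / 2)
        rw [e1] at h1
        rw [e2] at h2
        linarith
    _ = _ := by
        rw [Finset.mul_sum, Finset.mul_sum, ← Finset.sum_sub_distrib]
        exact Finset.sum_congr rfl fun s _ => by ring

/-- If the increments satisfy `|X_s| ≤ (s + 1) q Δ_s` with `Δ_s` known in advance, then with high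
probability, at all times at once, the partial sums are at most a small multiple of the weighted sum
of the `Δ_s ^ 2` plus a term linear in `t`. -/
lemma measure_exists_sum_sq_lt_sum_le [IsProbabilityMeasure μ] {n : ℕ}
    {F : ℕ → MeasurableSpace Ω} (hF : ∀ s ≤ n, F s ≤ m0) (hmono : Monotone F) {X Δ : ℕ → Ω → ℝ}
    {q γ ℓ C : ℝ} (hq : 0 ≤ q) (hγ : 0 < γ) (hℓ : 0 ≤ ℓ)
    (hX : ∀ s < n, Measurable[F (s + 1)] (X s)) (hΔ : ∀ s < n, Measurable[F s] (Δ s))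
    (hΔC : ∀ s < n, ∀ ω, Δ s ω ≤ C)
    (hXΔ : ∀ s < n, ∀ᵐ ω ∂μ, |X s ω| ≤ (s + 1) * q * Δ s ω)
    (hmean : ∀ s < n, μ[X s | F s] =ᵐ[μ] 0) :
    μ {ω | ∃ t < n, γ * ∑ s ∈ Finset.range (t + 1), ((s : ℝ) + 1) * Δ s ω ^ 2 +
        q ^ 2 * (t + 1) * ℓ / γ < ∑ s ∈ Finset.range (t + 1), X s ω} ≤
      ENNReal.ofReal ((Nat.log 2 n + 1 : ℕ) * Real.exp (-ℓ)) := by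
  -- for `q = 0` the increments vanish, and the exponents below would be divisions by zero
  rcases hq.eq_or_lt with hq0 | hq0
  · have h0 : ∀ᵐ ω ∂μ, ∀ s < n, |X s ω| ≤ (s + 1) * q * Δ s ω :=
      ae_all_iff.2 fun s => Filter.eventually_imp_distrib_left.2 (hXΔ s)
    refine le_of_eq_of_le (measure_eq_zero_iff_ae_notMem.2 ?_) zero_le
    filter_upwards [h0] with ω h
    rintro ⟨t, ht, hlt⟩
    have hX0 : ∑ s ∈ Finset.range (t + 1), X s ω = 0 := by
      refine Finset.sum_eq_zero fun s hs => ?_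
      have := h s ((Finset.mem_range.1 hs).trans_le ht)
      rw [← hq0, mul_zero, zero_mul] at this
      exact abs_nonpos_iff.1 this
    have : 0 ≤ γ * ∑ s ∈ Finset.range (t + 1), ((s : ℝ) + 1) * Δ s ω ^ 2 := by positivity
    rw [hX0, ← hq0] at hlt
    simp only [ne_eq, OfNat.ofNat_ne_zero, not_false_eq_true, zero_pow, zero_mul, zero_div,
      add_zero] at hlt
    linarith
  refine (measure_mono ?_).trans (measure_exists_epoch_lt_sum_le hF hmono hX
    (c := fun s ω => (s + 1) * q * Δ s ω) (C := n * q * |C|)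
    (fun s hs => (hΔ s hs).const_mul _) hXΔ
    (fun s hs => .of_forall fun ω => ?_)
    hmean (fun j => γ / (2 ^ j * q ^ 2)) (Nat.log 2 n + 1) ℓ)
  · rintro ω ⟨t, ht, hlt⟩
    refine ⟨Nat.log 2 (t + 1), Nat.lt_succ_of_le (Nat.log_mono_right ht), t + 1, ht, ?_⟩
    set j := Nat.log 2 (t + 1) with hj
    have hlow : (2 : ℝ) ^ j ≤ (t : ℝ) + 1 := by
      exact_mod_cast Nat.pow_log_le_self 2 (Nat.succ_ne_zero t)
    have hhigh : (t : ℝ) + 1 ≤ 2 * 2 ^ j := by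
      have := (Nat.lt_pow_succ_log_self (b := 2) (by norm_num) (t + 1)).le
      rw [pow_succ, mul_comm] at this
      exact_mod_cast this
    have h2j : (0 : ℝ) < 2 ^ j := by positivity
    set a : ℝ := γ / (2 ^ j * q ^ 2) with ha
    have ha0 : 0 < a := by positivity
    have hquad : ∑ s ∈ Finset.range (t + 1), a ^ 2 * (((s : ℝ) + 1) * q * Δ s ω) ^ 2 / 2 ≤
        a * (γ * ∑ s ∈ Finset.range (t + 1), ((s : ℝ) + 1) * Δ s ω ^ 2) := by
      rw [Finset.mul_sum, Finset.mul_sum]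
      refine Finset.sum_le_sum fun s hs => ?_
      have hs' : (s : ℝ) + 1 ≤ 2 * 2 ^ j := by
        refine le_trans ?_ hhigh
        exact_mod_cast Finset.mem_range.1 hs
      have e : a ^ 2 * (((s : ℝ) + 1) * q * Δ s ω) ^ 2 / 2 =
          a * γ * ((s : ℝ) + 1) * Δ s ω ^ 2 * (((s : ℝ) + 1) / (2 * 2 ^ j)) := by
        rw [ha]; field_simp
      rw [e]
      calc _ ≤ a * γ * ((s : ℝ) + 1) * Δ s ω ^ 2 * 1 :=
            mul_le_mul_of_nonneg_left (div_le_one_of_le₀ hs' (by positivity)) (by positivity)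
        _ = _ := by ring
    have hlin : ℓ ≤ a * (q ^ 2 * (t + 1) * ℓ / γ) := by
      have e : a * (q ^ 2 * (t + 1) * ℓ / γ) = ℓ * (((t : ℝ) + 1) / 2 ^ j) := by
        rw [ha]; field_simp
      rw [e]
      exact le_mul_of_one_le_right hℓ ((one_le_div h2j).2 hlow)
    have h1 := mul_lt_mul_of_pos_left hlt ha0
    rw [Finset.sum_sub_distrib, ← Finset.mul_sum]
    linarith
  · have h1 : (s : ℝ) + 1 ≤ n := by exact_mod_cast hs
    calc ((s : ℝ) + 1) * q * Δ s ω ≤ ((s : ℝ) + 1) * q * |C| :=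
          mul_le_mul_of_nonneg_left ((hΔC s hs ω).trans (le_abs_self C)) (by positivity)
      _ ≤ n * q * |C| := by gcongr

end Epochs

/-! ### Regret of the lazy update in one coordinate -/

lemma softThreshold_eq_zero {h x : ℝ} (hx : |x| ≤ h) : softThreshold h x = 0 := by
  unfold softThreshold
  split_ifs with hlt
  · rfl
  · have e : |x| = h := le_antisymm hx (not_lt.1 hlt)
    rcases lt_trichotomy x 0 with h0 | h0 | h0
    · rw [Real.sign_of_neg h0, ← e, abs_of_neg h0]; ring
    · rw [← e, h0]; simp
    · rw [Real.sign_of_pos h0, ← e, abs_of_pos h0]; ring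

/-- Soft-thresholding solves the `ℓ¹`-regularized quadratic problem, with the quadratic growth that
strong convexity gives. -/
lemma regularized_quadratic_ge {σ h θ : ℝ} (hσ : 0 < σ) (hh : 0 ≤ h) (w : ℝ) :
    σ / 2 * (1 / σ * softThreshold h θ) ^ 2 - θ * (1 / σ * softThreshold h θ) +
      h * |1 / σ * softThreshold h θ| + σ / 2 * (w - 1 / σ * softThreshold h θ) ^ 2 ≤
    σ / 2 * w ^ 2 - θ * w + h * |w| := by
  set v := 1 / σ * softThreshold h θ with hv
  have hσv : σ * v = softThreshold h θ := by rw [hv]; field_simp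
  -- the optimality condition: `θ - σ v` is a subgradient of `h |·|` at `v`
  have key : h * |v| + (θ - σ * v) * (w - v) ≤ h * |w| := by
    by_cases hlt : |θ| < h
    · have hs : softThreshold h θ = 0 := softThreshold_eq_zero hlt.le
      have hv0 : v = 0 := by rw [hv, hs, mul_zero]
      rw [hv0]
      simp only [abs_zero, mul_zero, sub_zero, zero_add]
      calc θ * w ≤ |θ * w| := le_abs_self _
        _ = |θ| * |w| := abs_mul _ _
        _ ≤ h * |w| := mul_le_mul_of_nonneg_right hlt.le (abs_nonneg _)
    · have hs : softThreshold h θ = θ - h * Real.sign θ := by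
        unfold softThreshold; rw [if_neg hlt]
      rw [hσv, hs]
      push Not at hlt
      rcases lt_trichotomy θ 0 with h0 | h0 | h0
      · rw [abs_of_neg h0] at hlt
        have hv0 : v ≤ 0 := by
          rw [hv, hs, Real.sign_of_neg h0]
          exact mul_nonpos_of_nonneg_of_nonpos (by positivity) (by linarith)
        rw [Real.sign_of_neg h0, abs_of_nonpos hv0]
        nlinarith [neg_abs_le w]
      · have hh0 : h = 0 := le_antisymm (by simpa [h0] using hlt) hh
        simp [h0, hh0]
      · rw [abs_of_pos h0] at hlt
        have hv0 : 0 ≤ v := by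
          rw [hv, hs, Real.sign_of_pos h0]
          exact mul_nonneg (by positivity) (by linarith)
        rw [Real.sign_of_pos h0, abs_of_nonneg hv0]
        nlinarith [le_abs_self w]
  nlinarith [key]

/-- The lower bound on the regularized potential behind the regret bound: each round adds its
linearized loss and the increase of the penalty, up to the stability term `g ^ 2 / η`. -/
lemma potential_ge {η : ℝ} (hη : 0 < η) {h : ℕ → ℝ} (h0 : h 0 = 0) (hmono : Monotone h)
    {g w θ : ℕ → ℝ} (hθ0 : θ 0 = 0)
    (hw : ∀ s, w s = 1 / (η * (((s : ℝ) + 1) * s / 2)) * softThreshold (h (s + 1)) (θ s))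
    (hθ : ∀ s, θ (s + 1) = θ s - ((s : ℝ) + 1) * (g s - η * w s)) (t : ℕ) :
    ∀ u : ℝ, ∑ s ∈ Finset.range t,
        (((s : ℝ) + 1) * g s * w s + (h (s + 1) - h s) * |w s| - g s ^ 2 / η) ≤
      η * (((t : ℝ) + 1) * t / 2) / 2 * u ^ 2 - θ t * u +
        ∑ s ∈ Finset.range t, ((s : ℝ) + 1) * (η / 2) * w s ^ 2 + h t * |u| := by
  have hpos : ∀ s, 0 ≤ h s := fun s => h0 ▸ hmono (Nat.zero_le s)
  induction t with
  | zero => intro u; simp [hθ0, h0]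
  | succ t ih =>
    intro u
    rw [Finset.sum_range_succ, Finset.sum_range_succ]
    have IH := ih (w t)
    set σ : ℝ := η * (((t : ℝ) + 1) * t / 2) with hσ
    have ht : (0 : ℝ) ≤ t := Nat.cast_nonneg t
    -- `w t` minimizes the potential of the previous rounds with the new penalty; in the first
    -- round the quadratic part vanishes and the minimizer is `0 = 1 / 0 * _`
    have hopt : σ / 2 * w t ^ 2 - θ t * w t + h (t + 1) * |w t| + σ / 2 * (u - w t) ^ 2 ≤
        σ / 2 * u ^ 2 - θ t * u + h (t + 1) * |u| := by
      rcases Nat.eq_zero_or_pos t with h1 | h1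
      · have hσ0 : σ = 0 := by rw [hσ, h1]; simp
        have hw0 : w t = 0 := by rw [hw t, ← hσ, hσ0]; simp
        have : 0 ≤ h (t + 1) * |u| := mul_nonneg (hpos _) (abs_nonneg _)
        have hθt : θ t = 0 := by rw [h1, hθ0]
        rw [hw0, hσ0, hθt]
        simpa using this
      · have h2 : (0 : ℝ) < t := by exact_mod_cast h1
        rw [hw t]
        exact regularized_quadratic_ge (by positivity) (hpos _) u
    have hstab : -(g t ^ 2 / η) ≤ ((t : ℝ) + 1) * g t * (u - w t) +
        η * (((t : ℝ) + 2) * (t + 1) / 2) / 2 * (u - w t) ^ 2 := by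
      have e : ((t : ℝ) + 1) * g t * (u - w t) +
          η * (((t : ℝ) + 2) * (t + 1) / 2) / 2 * (u - w t) ^ 2 + g t ^ 2 / η =
          (g t + η * ((t : ℝ) + 1) / 2 * (u - w t)) ^ 2 / η +
            η * ((t : ℝ) + 1) / 4 * (u - w t) ^ 2 := by
        field_simp
        ring
      have : 0 ≤ (g t + η * ((t : ℝ) + 1) / 2 * (u - w t)) ^ 2 / η +
            η * ((t : ℝ) + 1) / 4 * (u - w t) ^ 2 := by positivity
      linarith
    rw [hθ t]
    push_cast
    have e2 : η * (((t : ℝ) + 1 + 1) * (t + 1) / 2) = σ + η * (t + 1) := by rw [hσ]; ring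
    have e3 : η * (((t : ℝ) + 2) * (t + 1) / 2) = σ + η * (t + 1) := by rw [hσ]; ring
    rw [e3] at hstab
    rw [e2]
    linarith

lemma pow_three_halves_diff_le {s : ℝ} (hs : 0 ≤ s) :
    (s + 1) * √(s + 1) - s * √s ≤ 3 / 2 * √(s + 1) := by
  have hx := Real.sq_sqrt (show 0 ≤ s + 1 by linarith)
  have hy := Real.sq_sqrt hs
  have hyx : √s ≤ √(s + 1) := Real.sqrt_le_sqrt (by linarith)
  have hy0 := Real.sqrt_nonneg s
  set x := √(s + 1)
  set y := √s
  rw [← hx, ← hy]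
  have h1 : (x - y) * (x + y) = 1 := by nlinarith
  have h2 : 0 ≤ (x - y) * (x ^ 2 / 2 + x * y / 2 - y ^ 2) :=
    mul_nonneg (sub_nonneg.2 hyx) (by nlinarith [mul_le_mul hyx hyx hy0 (hy0.trans hyx)])
  nlinarith [h1, h2]

/-- Linearized regret of the weighted lazy update in one coordinate. The growth of the penalty is
paid for by a quadratic term, so no term of the size of the whole penalty is left. -/
lemma coordinate_regret_le {η lam : ℝ} (hη : 0 < η) (hlam : 0 ≤ lam) {g w θ : ℕ → ℝ}
    (hθ0 : θ 0 = 0)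
    (hw : ∀ s, w s = 1 / (η * (((s : ℝ) + 1) * s / 2)) *
      softThreshold (((s : ℝ) + 1) ^ (3 / 2 : ℝ) * lam) (θ s))
    (hθ : ∀ s, θ (s + 1) = θ s - ((s : ℝ) + 1) * (g s - η * w s)) (t : ℕ) (u : ℝ) :
    ∑ s ∈ Finset.range t, ((s : ℝ) + 1) * (g s * (w s - u)) ≤
      ∑ s ∈ Finset.range t, (((s : ℝ) + 1) * (3 * η / 4) * (w s - u) ^ 2 +
        (9 * lam ^ 2 / (4 * η) + g s ^ 2 / η)) := by
  set h : ℕ → ℝ := fun s => (s : ℝ) ^ (3 / 2 : ℝ) * lam with hh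
  have hmono : Monotone h := fun a b hab => mul_le_mul_of_nonneg_right
    (Real.rpow_le_rpow (Nat.cast_nonneg a) (by exact_mod_cast hab) (by norm_num)) hlam
  have h0 : h 0 = 0 := by simp [hh]
  have hpot := potential_ge hη h0 hmono hθ0 (fun s => by simpa [hh] using hw s) hθ t u
  have hθt : ∀ t, θ t = -∑ s ∈ Finset.range t, ((s : ℝ) + 1) * (g s - η * w s) := by
    intro t
    induction t with
    | zero => simp [hθ0]
    | succ t ih => rw [hθ, ih, Finset.sum_range_succ]; ring
  have hht : h t = ∑ s ∈ Finset.range t, (h (s + 1) - h s) := by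
    rw [Finset.sum_range_sub, h0, sub_zero]
  have hgauss : ((t : ℝ) + 1) * t / 2 = ∑ s ∈ Finset.range t, ((s : ℝ) + 1) := by
    clear hpot hht
    induction t with
    | zero => simp
    | succ t ih => rw [Finset.sum_range_succ, ← ih]; push_cast; ring
  rw [hθt t, hht, hgauss, Finset.sum_mul, Finset.mul_sum, Finset.sum_div, Finset.sum_mul,
    neg_mul, sub_neg_eq_add, Finset.sum_mul, ← Finset.sum_add_distrib, ← Finset.sum_add_distrib,
    ← Finset.sum_add_distrib] at hpot
  rw [← sub_nonneg, ← Finset.sum_sub_distrib] at hpot ⊢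
  refine hpot.trans (Finset.sum_le_sum fun s _ => ?_)
  have hs : (0 : ℝ) ≤ s := Nat.cast_nonneg s
  have hd0 : 0 ≤ h (s + 1) - h s := sub_nonneg.2 (hmono (Nat.le_succ s))
  have hd : h (s + 1) - h s ≤ 3 / 2 * √((s : ℝ) + 1) * lam := by
    simp only [hh]
    push_cast
    rw [rpow_three_halves hs, rpow_three_halves (by positivity), ← sub_mul]
    exact mul_le_mul_of_nonneg_right (pow_three_halves_diff_le hs) hlam
  have hx := Real.sq_sqrt (show (0 : ℝ) ≤ s + 1 by positivity)
  set x := √((s : ℝ) + 1)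
  have htri : |u| - |w s| ≤ |w s - u| := by
    rw [abs_sub_comm]; exact abs_sub_abs_le_abs_sub u (w s)
  have hpen : (h (s + 1) - h s) * (|u| - |w s|) ≤
      (s + 1) * (η / 4) * (w s - u) ^ 2 + 9 * lam ^ 2 / (4 * η) := by
    have e1 : (s + 1) * (η / 4) * (w s - u) ^ 2 + 9 * lam ^ 2 / (4 * η) -
        3 / 2 * x * lam * |w s - u| = (η * x * |w s - u| - 3 * lam) ^ 2 / (4 * η) := by
      rw [← hx, ← sq_abs (w s - u)]
      field_simp
      ring
    have e2 : 0 ≤ (η * x * |w s - u| - 3 * lam) ^ 2 / (4 * η) := by positivity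
    calc _ ≤ (h (s + 1) - h s) * |w s - u| := mul_le_mul_of_nonneg_left htri hd0
      _ ≤ 3 / 2 * x * lam * |w s - u| := mul_le_mul_of_nonneg_right hd (abs_nonneg _)
      _ ≤ _ := by linarith
  nlinarith [hpen]

/-! ### Random gradients and the expected loss -/

section Gradients

variable {Ω : Type*} {d : ℕ}

lemma gradient_apply_eq_fderiv (F : Vec d → ℝ) (w : Vec d) (i : Fin d) :
    gradient F w i = fderiv ℝ F w (EuclideanSpace.single i 1) := by
  rw [← inner_gradient_left, EuclideanSpace.inner_single_right]
  simp

lemma measurable_vec {m : MeasurableSpace Ω} {W : Ω → Vec d}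
    (h : ∀ i, Measurable[m] fun ω => W ω i) : Measurable[m] W :=
  (WithLp.measurable_toLp 2 (Fin d → ℝ)).comp (measurable_pi_iff.2 h)

lemma continuous_gradient_apply {F : Vec d → ℝ} (hF : ContDiff ℝ 1 F) (i : Fin d) :
    Continuous fun w => gradient F w i := by
  simp_rw [gradient_apply_eq_fderiv]
  exact (hF.continuous_fderiv one_ne_zero).clm_apply continuous_const

lemma measurable_gradient_apply_const (L : Vec d → ℝ) (i : Fin d) :
    Measurable fun v => gradient L v i := by
  simp_rw [gradient_apply_eq_fderiv]
  exact measurable_fderiv_apply_const ℝ L _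

/-- Partial derivatives of a random `C¹` function at a random point are measurable with respect to
any σ-algebra that contains the values of the function and the point. -/
lemma measurable_gradient_apply {m : MeasurableSpace Ω} {F : Ω → Vec d → ℝ}
    (hF : ∀ v, Measurable[m] fun ω => F ω v) (hC : ∀ ω, ContDiff ℝ 1 (F ω)) {W : Ω → Vec d}
    (hW : Measurable[m] W) (i : Fin d) : Measurable[m] fun ω => gradient (F ω) (W ω) i := by
  have hfix : ∀ w, Measurable[m] fun ω => gradient (F ω) w i := by
    intro w
    refine measurable_of_tendsto_metrizable
      (f := fun (n : ℕ) ω => (n : ℝ) • (F ω (w + (n : ℝ)⁻¹ • EuclideanSpace.single i (1 : ℝ)) -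
        F ω w)) (fun n => ((hF _).sub (hF w)).const_smul (n : ℝ)) ?_
    refine tendsto_pi_nhds.2 fun ω => ?_
    rw [gradient_apply_eq_fderiv]
    refine (((hC ω).differentiable one_ne_zero).differentiableAt.hasFDerivAt
      (x := w)).lim (EuclideanSpace.single i 1) ?_
    simpa using tendsto_natCast_atTop_atTop (R := ℝ)
  have huncurry : Measurable (Function.uncurry fun w ω => gradient (F ω) w i) :=
    measurable_uncurry_of_continuous_of_measurable
      (fun ω => continuous_gradient_apply (hC ω) i) hfix
  exact huncurry.comp (hW.prodMk measurable_id)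

lemma past_mono (f : ℕ → Ω → Vec d → ℝ) : Monotone (past f) := by
  intro s t hst
  refine biSup_mono fun r hr => ?_
  exact ⟨hr.1, hr.2.trans_le hst⟩

lemma measurable_past (f : ℕ → Ω → Vec d → ℝ) {s t : ℕ} (hs : 1 ≤ s) (hst : s < t) (w : Vec d) :
    Measurable[past f t] fun ω => f s ω w := by
  refine measurable_iff_comap_le.2 ?_
  exact (le_iSup (fun v : Vec d => MeasurableSpace.comap (fun ω => f s ω v) inferInstance) w).trans
    (le_iSup₂_of_le (f := fun s (_ : s ∈ Set.Ico 1 t) => ⨆ w : Vec d,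
      MeasurableSpace.comap (fun ω => f s ω w) inferInstance) s ⟨hs, hst⟩ le_rfl)

lemma isClosed_candidates (R : ℝ) (S : Finset (Fin d)) : IsClosed (candidates R S) := by
  have e : candidates R S = {w : Vec d | l1norm w ≤ R} ∩ ⋂ i ∈ (Sᶜ : Finset (Fin d)),
      {w : Vec d | w i = 0} := by
    ext w
    simp only [candidates, supp, Set.mem_ofPred_eq, Set.mem_inter_iff, Set.mem_iInter,
      Finset.mem_compl, Finset.subset_iff, Finset.mem_filter, Finset.mem_univ, true_and]
    exact and_congr_right fun _ => forall_congr' fun i => not_imp_comm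
  rw [e]
  refine IsClosed.inter (isClosed_le (by unfold l1norm; fun_prop) continuous_const) ?_
  exact isClosed_biInter fun i _ => isClosed_eq (by fun_prop) continuous_const

lemma apply_eq_zero_of_supp_subset {w : Vec d} {S : Finset (Fin d)} (h : supp w ⊆ S) {i : Fin d}
    (hi : i ∉ S) : w i = 0 := by
  by_contra hne
  exact hi (h (by simp [supp, hne]))

variable [MeasurableSpace Ω] {μ : Measure Ω} {f : ℕ → Ω → Vec d → ℝ} {T : ℕ} {R : ℝ}
  {S : Finset (Fin d)} {L : Vec d → ℝ} {wstar : Vec d} {k : ℕ}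

lemma RegularLosses.past_le (hreg : RegularLosses μ f T R S) {t : ℕ} (ht : t ≤ T + 1) :
    past f t ≤ ‹MeasurableSpace Ω› := by
  refine iSup₂_le fun s hs => iSup_le fun w => ?_
  obtain ⟨hs1, hs2⟩ := hs
  exact (hreg.measurable s (Finset.mem_Icc.2 ⟨hs1, by omega⟩) w).comap_le

lemma RegularLosses.measurable_gradient (hreg : RegularLosses μ f T R S) {t : ℕ}
    (ht : t ∈ Finset.Icc 1 T) (w : Vec d) : Measurable fun ω => gradient (f t ω) w :=
  measurable_vec fun i =>
    measurable_gradient_apply (hreg.measurable t ht) (hreg.contDiff t ht) measurable_const i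

lemma StatisticalSparsity.zero_mem (h1 : StatisticalSparsity μ f T L wstar R S k) :
    (0 : Vec d) ∈ candidates R S := by
  refine ⟨le_trans ?_ h1.l1norm_le, by simp [supp]⟩
  simp only [l1norm, PiLp.zero_apply, abs_zero, Finset.sum_const_zero]
  positivity

lemma StatisticalSparsity.wstar_mem (h1 : StatisticalSparsity μ f T L wstar R S k) :
    wstar ∈ candidates R S :=
  ⟨h1.l1norm_le, h1.supp_eq.le⟩

lemma ae_abs_gradient_apply_le {t : ℕ} {B : ℝ} (ht : t ∈ Finset.Icc 1 T)
    (h3 : BoundedGradients μ f T R S B) {W : Ω → Vec d} (hWH : ∀ ω, W ω ∈ candidates R S)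
    (i : Fin d) : ∀ᵐ ω ∂μ, |gradient (f t ω) (W ω) i| ≤ B := by
  filter_upwards [h3] with ω h using h t ht (W ω) (hWH ω) i

section Expectation

variable [IsProbabilityMeasure μ] {t : ℕ} {B : ℝ}

lemma setIntegral_loss (hreg : RegularLosses μ f T R S)
    (h1 : StatisticalSparsity μ f T L wstar R S k) (ht : t ∈ Finset.Icc 1 T)
    {A : Set Ω} (hA : MeasurableSet[past f t] A) (v : Vec d) :
    ∫ ω in A, f t ω v ∂μ = μ.real A * L v := by
  have hle : past f t ≤ ‹MeasurableSpace Ω› := hreg.past_le (by have := Finset.mem_Icc.1 ht; omega)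
  rw [← setIntegral_condExp hle (h1.integrable t ht v) hA,
    setIntegral_congr_ae (g := fun _ => L v) (hle _ hA)
      (by filter_upwards [h1.condExp_eq t ht v] with ω h _ using h)]
  simp

/-- Differentiation under the integral sign over an event of the past. -/
lemma hasFDerivAt_mul_loss (hreg : RegularLosses μ f T R S)
    (h1 : StatisticalSparsity μ f T L wstar R S k) (ht : t ∈ Finset.Icc 1 T)
    {A : Set Ω} (hA : MeasurableSet[past f t] A) {w : Vec d}
    (hw : w ∈ candidates R S) :
    HasFDerivAt (fun v => μ.real A * L v) (∫ ω in A, fderiv ℝ (f t ω) w ∂μ) w := by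
  obtain ⟨r, hr, G, hG, hbound⟩ := hreg.envelope t ht w hw
  have hdiff : ∀ ω v, HasFDerivAt (f t ω) (fderiv ℝ (f t ω) v) v := fun ω v =>
    ((hreg.contDiff t ht ω).differentiable one_ne_zero).differentiableAt.hasFDerivAt
  have hmeas : AEStronglyMeasurable (fun ω => fderiv ℝ (f t ω) w) μ := by
    have h3 := (InnerProductSpace.toDual ℝ (Vec d)).continuous.comp_aestronglyMeasurable
      (hreg.measurable_gradient ht w).aestronglyMeasurable (μ := μ)
    refine h3.congr (.of_forall fun ω => ?_)
    simp [gradient]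
  have h := hasFDerivAt_integral_of_dominated_of_fderiv_le (μ := μ.restrict A) (𝕜 := ℝ)
    (F := fun v ω => f t ω v) (F' := fun v ω => fderiv ℝ (f t ω) v) (x₀ := w) (bound := G)
    (Metric.ball_mem_nhds w hr)
    (.of_forall fun v => (h1.integrable t ht v).aestronglyMeasurable.restrict)
    (h1.integrable t ht w).integrableOn hmeas.restrict
    (ae_restrict_of_ae (by
      filter_upwards [hbound] with ω hω v hv
      have := hω v hv
      rwa [gradient, LinearIsometryEquiv.norm_map] at this))
    hG.integrableOn (.of_forall fun ω v _ => hdiff ω v)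
  simpa only [setIntegral_loss hreg h1 ht hA] using h

lemma differentiableAt_loss (hreg : RegularLosses μ f T R S)
    (h1 : StatisticalSparsity μ f T L wstar R S k) (ht : t ∈ Finset.Icc 1 T)
    {w : Vec d} (hw : w ∈ candidates R S) : DifferentiableAt ℝ L w := by
  have h := hasFDerivAt_mul_loss hreg h1 ht MeasurableSet.univ hw
  simp only [probReal_univ, one_mul] at h
  exact h.differentiableAt

lemma setIntegral_gradient_apply (hreg : RegularLosses μ f T R S)
    (h1 : StatisticalSparsity μ f T L wstar R S k) (ht : t ∈ Finset.Icc 1 T)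
    {A : Set Ω} (hA : MeasurableSet[past f t] A) {w : Vec d}
    (hw : w ∈ candidates R S) (i : Fin d) :
    ∫ ω in A, gradient (f t ω) w i ∂μ = μ.real A * gradient L w i := by
  have h := hasFDerivAt_mul_loss hreg h1 ht hA hw
  have h2 := ((differentiableAt_loss hreg h1 ht hw).hasFDerivAt.const_mul (μ.real A)).unique h
  have hint : IntegrableOn (fun ω => fderiv ℝ (f t ω) w) A μ := by
    obtain ⟨r, hr, G, hG, hbound⟩ := hreg.envelope t ht w hw
    have h3 : Integrable (fun ω => gradient (f t ω) w) μ := by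
      refine hG.mono' (hreg.measurable_gradient ht w).aestronglyMeasurable ?_
      filter_upwards [hbound] with ω hω using hω w (Metric.mem_ball_self hr)
    have h4 := (InnerProductSpace.toDual ℝ (Vec d)).toContinuousLinearEquiv.toContinuousLinearMap
      |>.integrable_comp h3
    refine (h4.congr (.of_forall fun ω => ?_)).integrableOn
    simp [gradient]
  simp_rw [gradient_apply_eq_fderiv]
  rw [← ContinuousLinearMap.integral_apply hint, ← h2]
  simp

lemma integrable_gradient_apply (hreg : RegularLosses μ f T R S) (ht : t ∈ Finset.Icc 1 T)
    (h3 : BoundedGradients μ f T R S B)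
    {W : Ω → Vec d} (hW : Measurable W)
    (hWH : ∀ ω, W ω ∈ candidates R S) (i : Fin d) :
    Integrable (fun ω => gradient (f t ω) (W ω) i) μ :=
  Integrable.of_bound (measurable_gradient_apply (hreg.measurable t ht)
    (hreg.contDiff t ht) hW i).aestronglyMeasurable B (ae_abs_gradient_apply_le ht h3 hWH i)

lemma gradient_loss_apply (hreg : RegularLosses μ f T R S)
    (h1 : StatisticalSparsity μ f T L wstar R S k) (ht : t ∈ Finset.Icc 1 T)
    {w : Vec d} (hw : w ∈ candidates R S) (i : Fin d) :
    gradient L w i = ∫ ω, gradient (f t ω) w i ∂μ := by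
  have h := setIntegral_gradient_apply hreg h1 ht MeasurableSet.univ hw i
  simpa using h.symm

lemma abs_gradient_loss_apply_le (hreg : RegularLosses μ f T R S)
    (h1 : StatisticalSparsity μ f T L wstar R S k) (ht : t ∈ Finset.Icc 1 T)
    (h3 : BoundedGradients μ f T R S B)
    {w : Vec d} (hw : w ∈ candidates R S) (i : Fin d) :
    |gradient L w i| ≤ B := by
  rw [gradient_loss_apply hreg h1 ht hw i]
  have := norm_integral_le_of_norm_le_const (μ := μ)
    (f := fun ω => gradient (f t ω) w i) (C := B) (ae_abs_gradient_apply_le ht h3 (fun _ => hw) i)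
  simpa using this

lemma tendsto_gradient_loss_apply (hreg : RegularLosses μ f T R S)
    (h1 : StatisticalSparsity μ f T L wstar R S k) (ht : t ∈ Finset.Icc 1 T)
    (h3 : BoundedGradients μ f T R S B)
    {w : ℕ → Vec d} {v : Vec d} (hw : ∀ n, w n ∈ candidates R S)
    (hv : v ∈ candidates R S) (h : Filter.Tendsto w Filter.atTop (nhds v)) (i : Fin d) :
    Filter.Tendsto (fun n => gradient L (w n) i) Filter.atTop (nhds (gradient L v i)) := by
  simp_rw [gradient_loss_apply hreg h1 ht (hw _) i, gradient_loss_apply hreg h1 ht hv i]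
  refine tendsto_integral_of_dominated_convergence (fun _ => B)
    (fun n => (integrable_gradient_apply hreg ht h3 measurable_const
      (fun _ => hw n) i).aestronglyMeasurable) (integrable_const B)
    (fun n => ae_abs_gradient_apply_le ht h3 (fun _ => hw n) i) (.of_forall fun ω => ?_)
  exact ((continuous_gradient_apply (hreg.contDiff t ht ω) i).tendsto v).comp h

lemma setIntegral_gradient_apply_of_finite_range (hreg : RegularLosses μ f T R S)
    (h1 : StatisticalSparsity μ f T L wstar R S k) (ht : t ∈ Finset.Icc 1 T)
    (h3 : BoundedGradients μ f T R S B) {V : Ω → Vec d}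
    (hV : Measurable[past f t] V) (hfin : (Set.range V).Finite)
    (hVH : ∀ ω, V ω ∈ candidates R S) {A : Set Ω} (hA : MeasurableSet[past f t] A) (i : Fin d) :
    ∫ ω in A, gradient (f t ω) (V ω) i ∂μ = ∫ ω in A, gradient L (V ω) i ∂μ := by
  have hle : past f t ≤ ‹MeasurableSpace Ω› := hreg.past_le (by have := Finset.mem_Icc.1 ht; omega)
  have hV0 : Measurable V := hV.mono hle le_rfl
  have hfib : ∀ v, MeasurableSet[past f t] (A ∩ V ⁻¹' {v}) := fun v =>
    hA.inter (hV (measurableSet_singleton v))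
  have hAU : A = ⋃ v ∈ hfin.toFinset, A ∩ V ⁻¹' {v} := by
    ext ω
    simp
  have hdisj : (↑hfin.toFinset : Set (Vec d)).PairwiseDisjoint fun v => A ∩ V ⁻¹' {v} := by
    intro u _ v _ huv
    exact Set.disjoint_left.2 fun ω hu hv => huv (hu.2.symm.trans hv.2)
  have hLint : Integrable (fun ω => gradient L (V ω) i) μ :=
    Integrable.of_bound ((measurable_gradient_apply_const L i).comp hV0).aestronglyMeasurable B
      (.of_forall fun ω => abs_gradient_loss_apply_le hreg h1 ht h3 (hVH ω) i)
  rw [hAU, integral_biUnion_finset _ (fun v _ => hle _ (hfib v)) hdisj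
      (fun v _ => (integrable_gradient_apply hreg ht h3 hV0 hVH i).integrableOn),
    integral_biUnion_finset _ (fun v _ => hle _ (hfib v)) hdisj
      (fun v _ => hLint.integrableOn)]
  refine Finset.sum_congr rfl fun v hv => ?_
  obtain ⟨ω₀, rfl⟩ := hfin.mem_toFinset.1 hv
  calc ∫ ω in A ∩ V ⁻¹' {V ω₀}, gradient (f t ω) (V ω) i ∂μ
      = ∫ ω in A ∩ V ⁻¹' {V ω₀}, gradient (f t ω) (V ω₀) i ∂μ :=
        setIntegral_congr_fun (hle _ (hfib _)) fun ω hω => by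
          simp only [show V ω = V ω₀ from hω.2]
    _ = ∫ ω in A ∩ V ⁻¹' {V ω₀}, gradient L (V ω₀) i ∂μ := by
        rw [setIntegral_gradient_apply hreg h1 ht (hfib _) (hVH ω₀) i]
        simp
    _ = ∫ ω in A ∩ V ⁻¹' {V ω₀}, gradient L (V ω) i ∂μ :=
        setIntegral_congr_fun (hle _ (hfib _)) fun ω hω => by
          simp only [show V ω = V ω₀ from hω.2]

/-- The current loss may be replaced by the expected loss in the conditional expectation of the
gradient at a point `W` chosen from the past. For `W` with finitely many values this is
`setIntegral_gradient_apply_of_finite_range`; the general case follows by approximation inside the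
closed set of candidates. -/
lemma condExp_gradient_apply (hreg : RegularLosses μ f T R S)
    (h1 : StatisticalSparsity μ f T L wstar R S k) (ht : t ∈ Finset.Icc 1 T)
    (h3 : BoundedGradients μ f T R S B)
    {W : Ω → Vec d} (hW : Measurable[past f t] W)
    (hWH : ∀ ω, W ω ∈ candidates R S) (i : Fin d) :
    μ[fun ω => gradient (f t ω) (W ω) i | past f t] =ᵐ[μ] fun ω => gradient L (W ω) i := by
  have hle : past f t ≤ ‹MeasurableSpace Ω› := hreg.past_le (by have := Finset.mem_Icc.1 ht; omega)
  have hLm := measurable_gradient_apply_const L i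
  have hLint : ∀ {V : Ω → Vec d}, Measurable V → (∀ ω, V ω ∈ candidates R S) →
      Integrable (fun ω => gradient L (V ω) i) μ := fun hV hVH =>
    Integrable.of_bound (hLm.comp hV).aestronglyMeasurable B
      (.of_forall fun ω => abs_gradient_loss_apply_le hreg h1 ht h3 (hVH ω) i)
  have hW0 : Measurable W := hW.mono hle le_rfl
  refine (ae_eq_condExp_of_forall_setIntegral_eq hle
    (integrable_gradient_apply hreg ht h3 hW0 hWH i)
    (fun A _ _ => (hLint hW0 hWH).integrableOn) ?_
    (hLm.comp hW).aestronglyMeasurable).symm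
  intro A hA _
  set V : ℕ → @SimpleFunc Ω (past f t) (Vec d) := fun n =>
    @SimpleFunc.approxOn (Vec d) Ω _ _ _ (past f t) W hW (candidates R S) 0 h1.zero_mem _ n
  have hVH : ∀ n ω, V n ω ∈ candidates R S := fun n ω =>
    @SimpleFunc.approxOn_mem (Vec d) Ω _ _ _ (past f t) W hW (candidates R S) 0 h1.zero_mem _ n ω
  have hVW : ∀ ω, Filter.Tendsto (fun n => V n ω) Filter.atTop (nhds (W ω)) := fun ω =>
    @SimpleFunc.tendsto_approxOn (Vec d) Ω _ _ _ (past f t) W hW (candidates R S) 0 h1.zero_mem _ ω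
      (subset_closure (hWH ω))
  have hVm' : ∀ n, Measurable[past f t] (V n) := fun n =>
    @SimpleFunc.measurable Ω (Vec d) (past f t) _ (V n)
  have hVfin : ∀ n, (Set.range (V n)).Finite := fun n =>
    @SimpleFunc.finite_range Ω (Vec d) (past f t) (V n)
  have hVm : ∀ n, Measurable (V n) := fun n => (hVm' n).mono hle le_rfl
  have hl1 : Filter.Tendsto (fun n => ∫ ω in A, gradient L (V n ω) i ∂μ) Filter.atTop
      (nhds (∫ ω in A, gradient L (W ω) i ∂μ)) :=
    tendsto_integral_of_dominated_convergence (fun _ => B)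
      (fun n => (hLm.comp (hVm n)).aestronglyMeasurable) (integrable_const B)
      (fun n => .of_forall fun ω => abs_gradient_loss_apply_le hreg h1 ht h3 (hVH n ω) i)
      (.of_forall fun ω => tendsto_gradient_loss_apply hreg h1 ht h3 (fun n => hVH n ω) (hWH ω)
        (hVW ω) i)
  have hl2 : Filter.Tendsto (fun n => ∫ ω in A, gradient (f t ω) (V n ω) i ∂μ) Filter.atTop
      (nhds (∫ ω in A, gradient (f t ω) (W ω) i ∂μ)) :=
    tendsto_integral_of_dominated_convergence (fun _ => B)
      (fun n => (integrable_gradient_apply hreg ht h3 (hVm n)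
        (hVH n) i).aestronglyMeasurable.restrict) (integrable_const B)
      (fun n => ae_restrict_of_ae (ae_abs_gradient_apply_le ht h3 (hVH n) i))
      (.of_forall fun ω => ((continuous_gradient_apply (hreg.contDiff t ht ω) i).tendsto _).comp
        (hVW ω))
  refine tendsto_nhds_unique hl1 (hl2.congr fun n => ?_)
  exact setIntegral_gradient_apply_of_finite_range hreg h1 ht h3 (hVm' n) (hVfin n) (hVH n) hA i

end Expectation

end Gradients

/-! ### Excess loss along a fixed sequence of losses -/

section Deterministic

variable {d : ℕ} {S : Finset (Fin d)} {L : Vec d → ℝ} {α : ℝ}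

lemma inner_eq_sum_of_supp (g : Vec d) {v : Vec d} (hv : ∀ i ∉ S, v i = 0) :
    inner ℝ g v = ∑ i ∈ S, g i * v i := by
  rw [PiLp.inner_apply, ← Finset.sum_subset (Finset.subset_univ S)]
  · exact Finset.sum_congr rfl fun i _ => by simp [mul_comm]
  · intro i _ hi
    simp [hv i hi]

lemma norm_sq_eq_sum_of_supp {v : Vec d} (hv : ∀ i ∉ S, v i = 0) :
    ‖v‖ ^ 2 = ∑ i ∈ S, v i ^ 2 := by
  rw [← real_inner_self_eq_norm_sq, inner_eq_sum_of_supp v hv]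
  exact Finset.sum_congr rfl fun i _ => (sq _).symm

lemma StronglyConvexOnSupport.convexOn (h2 : StronglyConvexOnSupport L α S) :
    ConvexOn ℝ Set.univ L := by
  have hsq : ConvexOn ℝ Set.univ fun w : Vec d => ∑ i ∈ S, (w i) ^ 2 := by
    refine ⟨convex_univ, fun x _ y _ a b ha hb hab => ?_⟩
    simp only [smul_eq_mul, Finset.mul_sum, ← Finset.sum_add_distrib]
    refine Finset.sum_le_sum fun i _ => ?_
    have := (even_two.convexOn_pow (𝕜 := ℝ)).2 (Set.mem_univ (x i)) (Set.mem_univ (y i)) ha hb hab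
    simpa using this
  have h := h2.2.add (hsq.smul (c := α / 2) (by linarith [h2.1]))
  refine h.congr fun w _ => ?_
  simp

/-- First-order condition for strong convexity on the coordinates in `S`. -/
lemma StronglyConvexOnSupport.add_inner_le (h2 : StronglyConvexOnSupport L α S) {w : Vec d}
    (hw : DifferentiableAt ℝ L w) (v : Vec d) :
    L w + inner ℝ (gradient L w) (v - w) + α / 2 * ∑ i ∈ S, (v i - w i) ^ 2 ≤ L v := by
  have hconv := h2.2.comp_affineMap (AffineMap.lineMap w v)
  have hL : HasDerivAt (fun r : ℝ => L (AffineMap.lineMap w v r))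
      (inner ℝ (gradient L w) (v - w)) 0 := by
    rw [inner_gradient_left]
    have h := AffineMap.hasDerivAt_lineMap (𝕜 := ℝ) (a := w) (b := v) (x := 0)
    refine HasFDerivAt.comp_hasDerivAt (0 : ℝ) ?_ h
    rw [AffineMap.lineMap_apply_zero]
    exact hw.hasFDerivAt
  have hq : HasDerivAt (fun r : ℝ => ∑ i ∈ S, (AffineMap.lineMap w v r : Vec d) i ^ 2)
      (∑ i ∈ S, 2 * w i * (v i - w i)) 0 := by
    refine HasDerivAt.fun_sum fun i _ => ?_
    have h : HasDerivAt (fun r : ℝ => (r * (v i - w i) + w i) ^ 2)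
        (2 * (0 * (v i - w i) + w i) ^ 1 * (1 * (v i - w i))) 0 := by
      simpa using (((hasDerivAt_id (0 : ℝ)).mul_const (v i - w i)).add_const (w i)).fun_pow 2
    have e : (fun r : ℝ => (AffineMap.lineMap w v r : Vec d) i ^ 2) =
        fun r => (r * (v i - w i) + w i) ^ 2 := by
      funext r
      simp [AffineMap.lineMap_apply]
    rw [e]
    exact h.congr_deriv (by ring)
  have h := hconv.le_slope_of_hasDerivAt (Set.mem_univ 0) (Set.mem_univ 1) one_pos
    (hL.sub (hq.const_mul (α / 2)))
  simp only [slope_def_field, Function.comp_apply, AffineMap.lineMap_apply_one,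
    AffineMap.lineMap_apply_zero, sub_zero, div_one] at h
  have e : ∑ i ∈ S, (v i - w i) ^ 2 = ∑ i ∈ S, v i ^ 2 - ∑ i ∈ S, w i ^ 2 -
      ∑ i ∈ S, 2 * w i * (v i - w i) := by
    rw [← Finset.sum_sub_distrib, ← Finset.sum_sub_distrib]
    exact Finset.sum_congr rfl fun i _ => by ring
  rw [e]
  linarith

variable {η lam ε : ℝ} {f : ℕ → Vec d → ℝ}

lemma average_succ (t : ℕ) : average η lam ε f (t + 1) =
    (1 - 2 / (((t + 1 : ℕ) : ℝ) + 1)) • average η lam ε f t +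
      (2 / (((t + 1 : ℕ) : ℝ) + 1)) • iterate η lam ε f (t + 1) := rfl

lemma theta_succ (t : ℕ) : (state η lam ε f (t + 1)).1 = (state η lam ε f t).1 -
    ((t + 1 : ℕ) : ℝ) • (gradient (f (t + 1)) (iterate η lam ε f (t + 1)) -
      η • iterate η lam ε f (t + 1)) := rfl

lemma iterate_succ_apply (t : ℕ) (i : Fin d) : iterate η lam 0 f (t + 1) i =
    1 / (η * (((t : ℝ) + 1) * t / 2)) *
      softThreshold (((t : ℝ) + 1) ^ (3 / 2 : ℝ) * lam) ((state η lam 0 f t).1 i) := by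
  simp [iterate, sparsify, softThresholdVec]

/-- The average `ŵ_t` carries the weights `s / (t (t + 1) / 2)`. -/
lemma average_loss_le (hL : ConvexOn ℝ Set.univ L) (c : ℝ) (t : ℕ) :
    (t : ℝ) * (t + 1) / 2 * (L (average η lam ε f t) - c) ≤
      ∑ s ∈ Finset.range t, ((s : ℝ) + 1) * (L (iterate η lam ε f (s + 1)) - c) := by
  induction t with
  | zero => simp
  | succ t ih =>
    rw [Finset.sum_range_succ, average_succ]
    have ht : (0 : ℝ) ≤ t := Nat.cast_nonneg t
    have hle : 2 / (((t + 1 : ℕ) : ℝ) + 1) ≤ 1 := by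
      rw [div_le_one (by positivity)]; push_cast; linarith
    have h := hL.2 (Set.mem_univ (average η lam ε f t))
      (Set.mem_univ (iterate η lam ε f (t + 1))) (sub_nonneg.2 hle) (by positivity)
      (sub_add_cancel 1 _)
    simp only [smul_eq_mul] at h
    set A := L (average η lam ε f t)
    set W := L (iterate η lam ε f (t + 1))
    set V := L ((1 - 2 / (((t + 1 : ℕ) : ℝ) + 1)) • average η lam ε f t +
      (2 / (((t + 1 : ℕ) : ℝ) + 1)) • iterate η lam ε f (t + 1))
    have hmul : ((t : ℝ) + 1) * (t + 2) / 2 * V ≤ t * (t + 1) / 2 * A + (t + 1) * W := by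
      calc _ ≤ ((t : ℝ) + 1) * (t + 2) / 2 * ((1 - 2 / (((t + 1 : ℕ) : ℝ) + 1)) * A +
            2 / (((t + 1 : ℕ) : ℝ) + 1) * W) := mul_le_mul_of_nonneg_left h (by positivity)
        _ = _ := by push_cast; field_simp; ring
    push_cast
    linarith

lemma average_apply_eq_zero {i : Fin d} {t : ℕ}
    (h : ∀ s < t, iterate η lam ε f (s + 1) i = 0) : average η lam ε f t i = 0 := by
  induction t with
  | zero => simp [average, state]
  | succ t ih =>
    rw [average_succ, PiLp.add_apply, PiLp.smul_apply, PiLp.smul_apply,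
      ih fun s hs => h s (by omega), h t (by omega)]
    simp

/-- Off the support the iterates vanish, so `θ` is a weighted sum of noise gradients there. -/
lemma theta_apply_eq_sum {i : Fin d} {t : ℕ} (h : ∀ s < t, iterate η lam ε f (s + 1) i = 0) :
    (state η lam ε f t).1 i =
      ∑ s ∈ Finset.range t,
        -(((s : ℝ) + 1) * gradient (f (s + 1)) (iterate η lam ε f (s + 1)) i) := by
  induction t with
  | zero => simp [state]
  | succ t ih =>
    rw [theta_succ, Finset.sum_range_succ, ← ih fun s hs => h s (by omega)]
    simp [h t (by omega), sub_eq_add_neg]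

/-- The deterministic part of the analysis: strong convexity in expectation and the coordinatewise
regret bounds control the excess loss by the noise, with a quadratic term to spare. -/
lemma sum_excess_loss_le (h2 : StronglyConvexOnSupport L α S) (hη : η = α / 2) (hlam : 0 ≤ lam)
    {B : ℝ} {k : ℕ} (hk : S.card ≤ k) {u : Vec d} (hu : ∀ i ∉ S, u i = 0) {t : ℕ}
    (hw : ∀ s < t, ∀ i ∉ S, iterate η lam 0 f (s + 1) i = 0)
    (hL : ∀ s < t, DifferentiableAt ℝ L (iterate η lam 0 f (s + 1)))
    (hB : ∀ s < t, ∀ i, |gradient (f (s + 1)) (iterate η lam 0 f (s + 1)) i| ≤ B) :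
    ∑ s ∈ Finset.range t, ((s : ℝ) + 1) * (L (iterate η lam 0 f (s + 1)) - L u) ≤
      ∑ s ∈ Finset.range t, ((s : ℝ) + 1) * inner ℝ (gradient L (iterate η lam 0 f (s + 1)) -
          gradient (f (s + 1)) (iterate η lam 0 f (s + 1))) (iterate η lam 0 f (s + 1) - u) -
        α / 8 * ∑ s ∈ Finset.range t, ((s : ℝ) + 1) * ‖iterate η lam 0 f (s + 1) - u‖ ^ 2 +
        t * (k * ((9 * lam ^ 2 / 2 + 2 * B ^ 2) / α)) := by
  have hα := h2.1
  have hη0 : 0 < η := by rw [hη]; linarith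
  set w : ℕ → Vec d := fun s => iterate η lam 0 f (s + 1) with hwdef
  set g : ℕ → Vec d := fun s => gradient (f (s + 1)) (w s) with hgdef
  have hsupp : ∀ s < t, ∀ i ∉ S, (w s - u) i = 0 := fun s hs i hi => by
    rw [PiLp.sub_apply, hu i hi, sub_zero]; exact hw s hs i hi
  have hregret : ∑ s ∈ Finset.range t, ((s : ℝ) + 1) * inner ℝ (g s) (w s - u) ≤
      ∑ s ∈ Finset.range t, (((s : ℝ) + 1) * (3 * α / 8) * ‖w s - u‖ ^ 2 +
        k * ((9 * lam ^ 2 / 2 + 2 * B ^ 2) / α)) := by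
    calc _ = ∑ i ∈ S, ∑ s ∈ Finset.range t, ((s : ℝ) + 1) * (g s i * (w s i - u i)) := by
          rw [Finset.sum_comm]
          refine Finset.sum_congr rfl fun s hs => ?_
          rw [inner_eq_sum_of_supp _ (hsupp s (Finset.mem_range.1 hs)), Finset.mul_sum]
          rfl
      _ ≤ ∑ i ∈ S, ∑ s ∈ Finset.range t, (((s : ℝ) + 1) * (3 * η / 4) * (w s i - u i) ^ 2 +
          (9 * lam ^ 2 / (4 * η) + g s i ^ 2 / η)) := by
          refine Finset.sum_le_sum fun i _ => ?_
          refine coordinate_regret_le hη0 hlam (θ := fun s => (state η lam 0 f s).1 i)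
            (by simp [state]) (fun s => iterate_succ_apply s i) (fun s => ?_) t (u i)
          simp [theta_succ, hwdef, hgdef]
      _ = ∑ s ∈ Finset.range t, (((s : ℝ) + 1) * (3 * η / 4) * ‖w s - u‖ ^ 2 +
          ∑ i ∈ S, (9 * lam ^ 2 / (4 * η) + g s i ^ 2 / η)) := by
          rw [Finset.sum_comm]
          refine Finset.sum_congr rfl fun s hs => ?_
          rw [norm_sq_eq_sum_of_supp (hsupp s (Finset.mem_range.1 hs)), Finset.sum_add_distrib,
            Finset.mul_sum]
          rfl
      _ ≤ _ := by
          refine Finset.sum_le_sum fun s hs => add_le_add (le_of_eq ?_) ?_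
          · rw [hη]; ring
          · have hbd : ∀ i ∈ S, 9 * lam ^ 2 / (4 * η) + g s i ^ 2 / η ≤
                (9 * lam ^ 2 / 2 + 2 * B ^ 2) / α := by
              intro i _
              have h3 : g s i ^ 2 ≤ B ^ 2 := by
                rw [← sq_abs]
                exact pow_le_pow_left₀ (abs_nonneg _) (hB s (Finset.mem_range.1 hs) i) 2
              have e : 9 * lam ^ 2 / (4 * η) + g s i ^ 2 / η =
                  (9 * lam ^ 2 / 2 + 2 * g s i ^ 2) / α := by rw [hη]; field_simp; ring
              rw [e]
              gcongr
            have hnn : 0 ≤ (9 * lam ^ 2 / 2 + 2 * B ^ 2) / α := by positivity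
            calc _ ≤ S.card • ((9 * lam ^ 2 / 2 + 2 * B ^ 2) / α) :=
                  Finset.sum_le_card_nsmul _ _ _ hbd
              _ ≤ _ := by
                rw [nsmul_eq_mul]
                exact mul_le_mul_of_nonneg_right (by exact_mod_cast hk) hnn
  have hconv : ∑ s ∈ Finset.range t, ((s : ℝ) + 1) * (L (w s) - L u) ≤
      ∑ s ∈ Finset.range t, ((s : ℝ) + 1) * (inner ℝ (gradient L (w s)) (w s - u) -
        α / 2 * ‖w s - u‖ ^ 2) := by
    refine Finset.sum_le_sum fun s hs => mul_le_mul_of_nonneg_left ?_ (by positivity)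
    have h := h2.add_inner_le (hL s (Finset.mem_range.1 hs)) u
    have e1 : inner ℝ (gradient L (w s)) (u - w s) = -inner ℝ (gradient L (w s)) (w s - u) := by
      rw [← inner_neg_right, neg_sub]
    have e2 : ∑ i ∈ S, (u i - w s i) ^ 2 = ‖w s - u‖ ^ 2 := by
      rw [norm_sq_eq_sum_of_supp (hsupp s (Finset.mem_range.1 hs))]
      exact Finset.sum_congr rfl fun i _ => by rw [PiLp.sub_apply]; ring
    have h' : L (w s) + inner ℝ (gradient L (w s)) (u - w s) +
      α / 2 * ∑ i ∈ S, (u i - w s i) ^ 2 ≤ L u := h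
    rw [e1, e2] at h'
    linarith
  have e : ∑ s ∈ Finset.range t, ((s : ℝ) + 1) * (inner ℝ (gradient L (w s)) (w s - u) -
        α / 2 * ‖w s - u‖ ^ 2) =
      ∑ s ∈ Finset.range t, ((s : ℝ) + 1) * inner ℝ (gradient L (w s) - g s) (w s - u) +
      ∑ s ∈ Finset.range t, ((s : ℝ) + 1) * inner ℝ (g s) (w s - u) -
      α / 2 * ∑ s ∈ Finset.range t, ((s : ℝ) + 1) * ‖w s - u‖ ^ 2 := by
    rw [Finset.mul_sum, ← Finset.sum_add_distrib, ← Finset.sum_sub_distrib]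
    refine Finset.sum_congr rfl fun s _ => ?_
    rw [inner_sub_left]
    ring
  have e3 : ∑ s ∈ Finset.range t, (((s : ℝ) + 1) * (3 * α / 8) * ‖w s - u‖ ^ 2 +
        k * ((9 * lam ^ 2 / 2 + 2 * B ^ 2) / α)) =
      3 * α / 8 * ∑ s ∈ Finset.range t, ((s : ℝ) + 1) * ‖w s - u‖ ^ 2 +
        t * (k * ((9 * lam ^ 2 / 2 + 2 * B ^ 2) / α)) := by
    rw [Finset.sum_add_distrib, Finset.sum_const, Finset.card_range, nsmul_eq_mul, Finset.mul_sum]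
    congr 1
    exact Finset.sum_congr rfl fun s _ => by ring
  rw [e3] at hregret
  rw [e] at hconv
  linarith

end Deterministic

/-! ### Clipped iterates and the two noise events -/

section Clipped

variable {d : ℕ} {R η lam : ℝ} {S : Finset (Fin d)}

open Classical in
/-- The iterate `w_{s+1}`, replaced by `0` where it is not a candidate. It is a candidate for every
outcome, so that the gradient bound and the conditional expectations are available without
conditioning on the good event, on which it is the iterate itself. -/
noncomputable def clippedIterate (R : ℝ) (S : Finset (Fin d)) (η lam : ℝ) (f : ℕ → Vec d → ℝ)
    (s : ℕ) : Vec d :=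
  if iterate η lam 0 f (s + 1) ∈ candidates R S then iterate η lam 0 f (s + 1) else 0

lemma clippedIterate_of_mem {f : ℕ → Vec d → ℝ} {s : ℕ}
    (h : iterate η lam 0 f (s + 1) ∈ candidates R S) :
    clippedIterate R S η lam f s = iterate η lam 0 f (s + 1) := if_pos h

lemma clippedIterate_mem (h0 : (0 : Vec d) ∈ candidates R S) (f : ℕ → Vec d → ℝ) (s : ℕ) :
    clippedIterate R S η lam f s ∈ candidates R S := by
  unfold clippedIterate
  split_ifs with h
  exacts [h, h0]

/-- While the weighted noise gradients off `S` stay below the thresholds, no coordinate off `S` is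
ever activated. -/
lemma iterate_mem_candidates {f : ℕ → Vec d → ℝ} {T : ℕ}
    (hball : ∀ t ∈ Finset.Icc 1 T, (∀ s ∈ Finset.Icc 1 t, supp (iterate η lam 0 f s) ⊆ S) →
      l1norm (iterate η lam 0 f t) ≤ R)
    (hnoise : ∀ i ∉ S, ∀ t < T, |∑ s ∈ Finset.range t,
      ((s : ℝ) + 1) * gradient (f (s + 1)) (clippedIterate R S η lam f s) i| ≤
        ((t : ℝ) + 1) ^ (3 / 2 : ℝ) * lam) :
    ∀ t < T, iterate η lam 0 f (t + 1) ∈ candidates R S := by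
  intro t
  induction t using Nat.strong_induction_on with
  | _ t ih =>
    intro ht
    have hprev : ∀ s < t, iterate η lam 0 f (s + 1) ∈ candidates R S := fun s hs =>
      ih s hs (hs.trans ht)
    have hsupp : supp (iterate η lam 0 f (t + 1)) ⊆ S := by
      intro i hi
      by_contra hiS
      refine (Finset.mem_filter.1 hi).2 ?_
      rw [iterate_succ_apply, softThreshold_eq_zero, mul_zero]
      rw [theta_apply_eq_sum fun s hs => apply_eq_zero_of_supp_subset (hprev s hs).2 hiS,
        Finset.sum_neg_distrib, abs_neg]
      refine le_of_eq_of_le ?_ (hnoise i hiS t ht)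
      congr 1
      refine Finset.sum_congr rfl fun s hs => ?_
      rw [clippedIterate_of_mem (hprev s (Finset.mem_range.1 hs))]
    refine ⟨hball (t + 1) (Finset.mem_Icc.2 ⟨by omega, ht⟩) fun s hs => ?_, hsupp⟩
    obtain ⟨hs1, hs2⟩ := Finset.mem_Icc.1 hs
    obtain ⟨r, rfl⟩ := Nat.exists_eq_add_of_le' hs1
    rcases (show r ≤ t by omega).eq_or_lt with rfl | h
    · exact hsupp
    · exact (hprev r h).2

lemma measurable_softThreshold (h : ℝ) : Measurable (softThreshold h) := by
  have hsign : Measurable Real.sign :=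
    Measurable.ite measurableSet_Iio measurable_const
      (Measurable.ite measurableSet_Ioi measurable_const measurable_const)
  exact Measurable.ite (measurableSet_lt continuous_abs.measurable measurable_const)
    measurable_const (measurable_id.sub (hsign.const_mul h))

lemma norm_le_l1norm (w : Vec d) : ‖w‖ ≤ l1norm w := by
  have h0 : 0 ≤ l1norm w := Finset.sum_nonneg fun i _ => abs_nonneg _
  refine abs_le_of_sq_le_sq' ?_ h0 |>.2
  rw [EuclideanSpace.norm_sq_eq]
  exact Finset.sum_sq_le_sq_sum_of_nonneg fun i _ => abs_nonneg _

variable {Ω : Type*} [MeasurableSpace Ω] {μ : Measure Ω} {f : ℕ → Ω → Vec d → ℝ} {T : ℕ}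
  {L : Vec d → ℝ} {wstar : Vec d} {k : ℕ} {B ℓ : ℝ}

lemma RegularLosses.measurable_theta (hreg : RegularLosses μ f T R S) {t : ℕ} (ht : t ≤ T) :
    Measurable[past f (t + 1)] fun ω => (state η lam 0 (fun j => f j ω) t).1 := by
  induction t with
  | zero => exact measurable_const
  | succ t ih =>
    have hθ : Measurable[past f (t + 1 + 1)] fun ω => (state η lam 0 (fun j => f j ω) t).1 :=
      (ih (by omega)).mono (past_mono f (Nat.le_succ _)) le_rfl
    have hθi : ∀ i, Measurable[past f (t + 1 + 1)] fun ω =>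
        (state η lam 0 (fun j => f j ω) t).1 i := fun i =>
      (show Measurable fun v : Vec d => v i by fun_prop).comp hθ
    have hit : Measurable[past f (t + 1 + 1)] fun ω =>
        iterate η lam 0 (fun j => f j ω) (t + 1) := by
      refine measurable_vec fun i => ?_
      simp_rw [iterate_succ_apply]
      exact ((measurable_softThreshold _).comp (hθi i)).const_mul _
    refine measurable_vec fun i => ?_
    simp only [theta_succ, PiLp.sub_apply, PiLp.smul_apply, smul_eq_mul]
    have hg : Measurable[past f (t + 1 + 1)] fun ω =>
        gradient (f (t + 1) ω) (iterate η lam 0 (fun j => f j ω) (t + 1)) i :=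
      measurable_gradient_apply (fun v => measurable_past f (by omega) (by omega) v)
        (hreg.contDiff (t + 1) (Finset.mem_Icc.2 ⟨by omega, ht⟩)) hit i
    have hiti : Measurable[past f (t + 1 + 1)] fun ω =>
        iterate η lam 0 (fun j => f j ω) (t + 1) i :=
      (show Measurable fun v : Vec d => v i by fun_prop).comp hit
    exact (hθi i).sub ((hg.sub (hiti.const_mul η)).const_mul _)

lemma RegularLosses.measurable_clippedIterate (hreg : RegularLosses μ f T R S) {s : ℕ}
    (hs : s < T) :
    Measurable[past f (s + 1)] fun ω => clippedIterate R S η lam (fun j => f j ω) s := by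
  have hit : Measurable[past f (s + 1)] fun ω => iterate η lam 0 (fun j => f j ω) (s + 1) := by
    refine measurable_vec fun i => ?_
    simp_rw [iterate_succ_apply]
    exact ((measurable_softThreshold _).comp ((show Measurable fun v : Vec d => v i by
      fun_prop).comp (hreg.measurable_theta hs.le))).const_mul _
  exact Measurable.ite (hit (isClosed_candidates R S).measurableSet) hit measurable_const

variable [IsProbabilityMeasure μ]

lemma gradient_clippedIterate_properties (hreg : RegularLosses μ f T R S)
    (h1 : StatisticalSparsity μ f T L wstar R S k) (h3 : BoundedGradients μ f T R S B) {s : ℕ}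
    (hs : s < T) (i : Fin d) :
    (Measurable[past f (s + 1 + 1)] fun ω =>
      gradient (f (s + 1) ω) (clippedIterate R S η lam (fun j => f j ω) s) i) ∧
    (∀ᵐ ω ∂μ, |gradient (f (s + 1) ω) (clippedIterate R S η lam (fun j => f j ω) s) i| ≤ B) ∧
    μ[fun ω => gradient (f (s + 1) ω) (clippedIterate R S η lam (fun j => f j ω) s) i |
        past f (s + 1)] =ᵐ[μ]
      fun ω => gradient L (clippedIterate R S η lam (fun j => f j ω) s) i := by
  have ht : s + 1 ∈ Finset.Icc 1 T := Finset.mem_Icc.2 ⟨by omega, hs⟩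
  have hmem := fun ω => clippedIterate_mem (η := η) (lam := lam) h1.zero_mem (fun j => f j ω) s
  have hm := hreg.measurable_clippedIterate (η := η) (lam := lam) hs
  exact ⟨measurable_gradient_apply (fun v => measurable_past f (by omega) (by omega) v)
      (hreg.contDiff _ ht) (hm.mono (past_mono f (Nat.le_succ _)) le_rfl) i,
    ae_abs_gradient_apply_le ht h3 hmem i,
    condExp_gradient_apply hreg h1 ht h3 hm hmem i⟩

/-- A feature outside the support is orthogonal to the gradients in expectation, so its weighted
gradients form a martingale, which stays below the threshold up to a small probability. The sign `c`
serves to treat both tails. -/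
lemma measure_noise_feature_le (hreg : RegularLosses μ f T R S)
    (h1 : StatisticalSparsity μ f T L wstar R S k) (h3 : BoundedGradients μ f T R S B)
    (h4 : OrthogonalNoise L R S) (hB : 0 ≤ B) (hℓ : 0 < ℓ) {i : Fin d} (hi : i ∉ S) {c : ℝ}
    (hc : |c| = 1) :
    μ {ω | ∃ t < T, 3 * B / 2 * √ℓ * ((t : ℝ) + 1) ^ (3 / 2 : ℝ) < ∑ s ∈ Finset.range t,
      c * (((s : ℝ) + 1) *
        gradient (f (s + 1) ω) (clippedIterate R S η lam (fun j => f j ω) s) i)} ≤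
      ENNReal.ofReal ((Nat.log 2 T + 1 : ℕ) * Real.exp (-ℓ)) := by
  refine measure_exists_boundary_lt_sum_le (F := fun s => past f (s + 1))
    (fun s hs => hreg.past_le (by omega)) (fun a b hab => past_mono f (Nat.succ_le_succ hab))
    (X := fun s ω => c * (((s : ℝ) + 1) *
        gradient (f (s + 1) ω) (clippedIterate R S η lam (fun j => f j ω) s) i)) hB hℓ ?_ ?_ ?_
  · intro s hs
    exact ((gradient_clippedIterate_properties hreg h1 h3 hs i).1.const_mul _).const_mul _
  · intro s hs
    filter_upwards [(gradient_clippedIterate_properties hreg h1 h3 hs i).2.1] with ω h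
    rw [abs_mul, hc, one_mul, abs_mul, abs_of_nonneg (by positivity : (0 : ℝ) ≤ (s : ℝ) + 1)]
    exact mul_le_mul_of_nonneg_left h (by positivity)
  · intro s hs
    simp_rw [← mul_assoc]
    refine (condExp_smul (c * ((s : ℝ) + 1)) (fun ω => gradient (f (s + 1) ω)
      (clippedIterate R S η lam (fun j => f j ω) s) i) (past f (s + 1))).trans ?_
    filter_upwards [(gradient_clippedIterate_properties hreg h1 h3 hs i).2.2] with ω h
    rw [Pi.smul_apply, h, h4 _ (clippedIterate_mem h1.zero_mem _ _) i hi]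
    simp

/-- The deviation of the gradients from their conditional expectations, in the direction of the
error of the iterates. The error itself bounds the increments, which makes the deviation absorbable
into the quadratic term that strong convexity leaves. -/
lemma measure_gradient_noise_le (hreg : RegularLosses μ f T R S)
    (h1 : StatisticalSparsity μ f T L wstar R S k) (h3 : BoundedGradients μ f T R S B)
    (hB : 0 ≤ B) (hℓ : 0 ≤ ℓ) {γ : ℝ} (hγ : 0 < γ) :
    μ {ω | ∃ t < T, γ * ∑ s ∈ Finset.range (t + 1), ((s : ℝ) + 1) *
        ‖clippedIterate R S η lam (fun j => f j ω) s - wstar‖ ^ 2 +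
          (2 * B * √k) ^ 2 * (t + 1) * ℓ / γ <
        ∑ s ∈ Finset.range (t + 1), ((s : ℝ) + 1) *
          inner ℝ (gradient L (clippedIterate R S η lam (fun j => f j ω) s) -
            gradient (f (s + 1) ω) (clippedIterate R S η lam (fun j => f j ω) s))
            (clippedIterate R S η lam (fun j => f j ω) s - wstar)} ≤
      ENNReal.ofReal ((Nat.log 2 T + 1 : ℕ) * Real.exp (-ℓ)) := by
  set W : ℕ → Ω → Vec d := fun s ω => clippedIterate R S η lam (fun j => f j ω) s with hW
  have hmem : ∀ s ω, W s ω ∈ candidates R S := fun s ω => clippedIterate_mem h1.zero_mem _ _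
  have hWm : ∀ s < T, Measurable[past f (s + 1)] (W s) := fun s hs =>
    hreg.measurable_clippedIterate hs
  have hWim : ∀ s < T, ∀ i, Measurable[past f (s + 1)] fun ω => W s ω i := fun s hs i =>
    (show Measurable fun v : Vec d => v i by fun_prop).comp (hWm s hs)
  have hLm : ∀ s < T, ∀ i, Measurable[past f (s + 1)] fun ω => gradient L (W s ω) i :=
    fun s hs i => (measurable_gradient_apply_const L i).comp (hWm s hs)
  have hzero : ∀ s ω, ∀ i ∉ S, (W s ω - wstar) i = 0 := fun s ω i hi => by
    rw [PiLp.sub_apply, apply_eq_zero_of_supp_subset (hmem s ω).2 hi,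
      apply_eq_zero_of_supp_subset h1.wstar_mem.2 hi, sub_zero]
  have hΔC : ∀ s ω, ‖W s ω - wstar‖ ≤ R + R := fun s ω =>
    (norm_sub_le _ _).trans (add_le_add ((norm_le_l1norm _).trans (hmem s ω).1)
      ((norm_le_l1norm _).trans h1.l1norm_le))
  have hle : ∀ s ≤ T, past f (s + 1) ≤ ‹MeasurableSpace Ω› := fun s hs => hreg.past_le (by omega)
  have hdiff : ∀ s < T, ∀ᵐ ω ∂μ, ∀ i,
      |gradient L (W s ω) i - gradient (f (s + 1) ω) (W s ω) i| ≤ 2 * B := by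
    intro s hs
    have ht : s + 1 ∈ Finset.Icc 1 T := Finset.mem_Icc.2 ⟨by omega, hs⟩
    refine ae_all_iff.2 fun i => ?_
    filter_upwards [(gradient_clippedIterate_properties hreg h1 h3 hs i).2.1] with ω h
    have h' := abs_gradient_loss_apply_le hreg h1 ht h3 (hmem s ω) i
    have := abs_sub (gradient L (W s ω) i) (gradient (f (s + 1) ω) (W s ω) i)
    linarith
  refine measure_exists_sum_sq_lt_sum_le (F := fun s => past f (s + 1)) hle
    (fun a b hab => past_mono f (Nat.succ_le_succ hab)) (C := R + R)
    (X := fun s ω => ((s : ℝ) + 1) * inner ℝ (gradient L (W s ω) -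
      gradient (f (s + 1) ω) (W s ω)) (W s ω - wstar))
    (Δ := fun s ω => ‖W s ω - wstar‖)
    (by positivity) hγ hℓ ?_ ?_ (fun s _ ω => hΔC s ω) ?_ ?_
  · intro s hs
    simp_rw [inner_eq_sum_of_supp _ (hzero s _)]
    refine Measurable.const_mul (Finset.measurable_fun_sum _ fun i _ => ?_) _
    have hmono := past_mono f (Nat.le_succ (s + 1))
    exact (((hLm s hs i).mono hmono le_rfl).sub
      (gradient_clippedIterate_properties hreg h1 h3 hs i).1).mul
      (((hWim s hs i).mono hmono le_rfl).sub measurable_const)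
  · intro s hs
    exact (measurable_norm.comp ((show Measurable fun v : Vec d => v - wstar by fun_prop).comp
      (hWm s hs)))
  · intro s hs
    filter_upwards [hdiff s hs] with ω h
    rw [abs_mul, abs_of_nonneg (by positivity : (0 : ℝ) ≤ (s : ℝ) + 1), mul_assoc ((s : ℝ) + 1)]
    refine mul_le_mul_of_nonneg_left ?_ (by positivity)
    rw [inner_eq_sum_of_supp _ (hzero s ω)]
    have hcs : ∑ i ∈ S, |(W s ω - wstar) i| ≤ √k * ‖W s ω - wstar‖ := by
      refine abs_le_of_sq_le_sq' ?_ (by positivity) |>.2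
      rw [mul_pow, Real.sq_sqrt (Nat.cast_nonneg k), norm_sq_eq_sum_of_supp (hzero s ω)]
      refine (sq_sum_le_card_mul_sum_sq (s := S)).trans ?_
      simp_rw [sq_abs]
      exact mul_le_mul_of_nonneg_right (by exact_mod_cast h1.card_le)
        (Finset.sum_nonneg fun i _ => sq_nonneg _)
    calc _ ≤ ∑ i ∈ S, 2 * B * |(W s ω - wstar) i| := by
          refine (Finset.abs_sum_le_sum_abs _ _).trans (Finset.sum_le_sum fun i _ => ?_)
          rw [abs_mul]
          exact mul_le_mul_of_nonneg_right (h i) (abs_nonneg _)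
      _ ≤ 2 * B * (√k * ‖W s ω - wstar‖) := by
          rw [← Finset.mul_sum]
          exact mul_le_mul_of_nonneg_left hcs (by positivity)
      _ = _ := by ring
  · intro s hs
    have ht : s + 1 ∈ Finset.Icc 1 T := Finset.mem_Icc.2 ⟨by omega, hs⟩
    set Z : Fin d → Ω → ℝ := fun i ω => ((s : ℝ) + 1) * (W s ω - wstar) i with hZ
    set Y : Fin d → Ω → ℝ := fun i ω =>
      gradient L (W s ω) i - gradient (f (s + 1) ω) (W s ω) i with hY
    have hZm : ∀ i, Measurable[past f (s + 1)] (Z i) := fun i =>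
      ((hWim s hs i).sub measurable_const).const_mul _
    have hgint : ∀ i, Integrable (fun ω => gradient (f (s + 1) ω) (W s ω) i) μ := fun i =>
      integrable_gradient_apply hreg ht h3 ((hWm s hs).mono (hle s hs.le) le_rfl) (hmem s) i
    have hLint : ∀ i, Integrable (fun ω => gradient L (W s ω) i) μ := fun i =>
      Integrable.of_bound ((hLm s hs i).mono (hle s hs.le) le_rfl).aestronglyMeasurable B
        (.of_forall fun ω => abs_gradient_loss_apply_le hreg h1 ht h3 (hmem s ω) i)
    have hYint : ∀ i, Integrable (Y i) μ := fun i => (hLint i).sub (hgint i)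
    have hZY : ∀ i, Integrable (Z i * Y i) μ := by
      intro i
      refine (hYint i).bdd_mul (c := ((s : ℝ) + 1) * (R + R))
        ((hZm i).mono (hle s hs.le) le_rfl).aestronglyMeasurable (.of_forall fun ω => ?_)
      rw [hZ, norm_mul, Real.norm_of_nonneg (by positivity : (0 : ℝ) ≤ (s : ℝ) + 1)]
      exact mul_le_mul_of_nonneg_left ((PiLp.norm_apply_le _ i).trans (hΔC s ω)) (by positivity)
    have hYmean : ∀ i, μ[Y i | past f (s + 1)] =ᵐ[μ] 0 := by
      intro i
      filter_upwards [condExp_sub (hLint i) (hgint i) (past f (s + 1)),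
        (gradient_clippedIterate_properties hreg h1 h3 hs i).2.2] with ω e1 e2
      refine e1.trans ?_
      rw [Pi.sub_apply, condExp_of_stronglyMeasurable (hle s hs.le) (hLm s hs i).stronglyMeasurable
        (hLint i), e2, sub_self, Pi.zero_apply]
    have e : (fun ω => ((s : ℝ) + 1) * inner ℝ (gradient L (W s ω) -
        gradient (f (s + 1) ω) (W s ω)) (W s ω - wstar)) = ∑ i ∈ S, Z i * Y i := by
      funext ω
      rw [inner_eq_sum_of_supp _ (hzero s ω), Finset.mul_sum, Finset.sum_apply]
      refine Finset.sum_congr rfl fun i _ => ?_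
      simp only [hZ, hY, Pi.mul_apply, PiLp.sub_apply]
      ring
    rw [e]
    refine (condExp_finsetSum (fun i _ => hZY i) _).trans ?_
    have hall : ∀ᵐ ω ∂μ, ∀ i, (μ[Z i * Y i | past f (s + 1)]) ω = 0 := by
      refine ae_all_iff.2 fun i => ?_
      filter_upwards [condExp_mul_of_stronglyMeasurable_left (hZm i).stronglyMeasurable (hZY i)
        (hYint i), hYmean i] with ω e1 e2
      rw [e1, Pi.mul_apply, e2, Pi.zero_apply, mul_zero]
    filter_upwards [hall] with ω h
    rw [Finset.sum_apply, Finset.sum_eq_zero fun i _ => h i, Pi.zero_apply]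

end Clipped

/-! ### From the noise events to the prediction error -/

section Rate

variable {Ω : Type*} [MeasurableSpace Ω] {μ : Measure Ω} [IsProbabilityMeasure μ] {d : ℕ}
  {f : ℕ → Ω → Vec d → ℝ} {T k : ℕ} {L : Vec d → ℝ} {wstar : Vec d} {S : Finset (Fin d)}
  {R B α η lam ℓ : ℝ}

/-- Outside an event of small probability, all iterates are candidates. -/
lemma exists_support_event (hreg : RegularLosses μ f T R S)
    (h1 : StatisticalSparsity μ f T L wstar R S k) (h3 : BoundedGradients μ f T R S B)
    (h4 : OrthogonalNoise L R S) (hball : IteratesInBall μ f T R S η lam 0) (hB : 0 ≤ B)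
    (hℓ : 0 < ℓ) (hlam : lam = 3 * B / 2 * √ℓ) :
    ∃ E : Set Ω, μ E ≤ ENNReal.ofReal (d * (2 * ((Nat.log 2 T + 1 : ℕ) * Real.exp (-ℓ)))) ∧
      ∀ᵐ ω ∂μ, ω ∉ E → ∀ t < T, iterate η lam 0 (fun j => f j ω) (t + 1) ∈ candidates R S := by
  set b : ℝ := (Nat.log 2 T + 1 : ℕ) * Real.exp (-ℓ) with hb
  have hb0 : 0 ≤ b := by positivity
  set N : ℝ → Fin d → Set Ω := fun c i => {ω | ∃ t < T,
    3 * B / 2 * √ℓ * ((t : ℝ) + 1) ^ (3 / 2 : ℝ) < ∑ s ∈ Finset.range t,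
      c * (((s : ℝ) + 1) *
        gradient (f (s + 1) ω) (clippedIterate R S η lam (fun j => f j ω) s) i)}
  have hNle : ∀ c, |c| = 1 → ∀ i ∉ S, μ (N c i) ≤ ENNReal.ofReal b := fun c hc i hi =>
    measure_noise_feature_le hreg h1 h3 h4 hB hℓ hi hc
  refine ⟨⋃ i ∈ Sᶜ, (N 1 i ∪ N (-1) i), ?_, ?_⟩
  · calc μ (⋃ i ∈ Sᶜ, (N 1 i ∪ N (-1) i)) ≤ ∑ i ∈ Sᶜ, μ (N 1 i ∪ N (-1) i) :=
          measure_biUnion_finset_le _ _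
      _ ≤ ∑ i ∈ Sᶜ, ENNReal.ofReal (2 * b) := by
          refine Finset.sum_le_sum fun i hi => ?_
          rw [two_mul, ENNReal.ofReal_add hb0 hb0]
          have hi' := Finset.mem_compl.1 hi
          exact (measure_union_le _ _).trans
            (add_le_add (hNle 1 (by norm_num) i hi') (hNle (-1) (by norm_num) i hi'))
      _ ≤ ∑ i : Fin d, ENNReal.ofReal (2 * b) :=
          Finset.sum_le_sum_of_subset (Finset.subset_univ _)
      _ = ENNReal.ofReal (d * (2 * b)) := by
          rw [Finset.sum_const, Finset.card_univ, Fintype.card_fin, nsmul_eq_mul,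
            ENNReal.ofReal_mul (Nat.cast_nonneg d), ENNReal.ofReal_natCast]
  · filter_upwards [hball] with ω hω hE
    refine iterate_mem_candidates hω fun i hi t ht => ?_
    have hmem : ω ∉ N 1 i ∧ ω ∉ N (-1) i := by
      simp only [Set.mem_iUnion, Finset.mem_compl, not_exists] at hE
      simpa only [Set.mem_union, not_or] using hE i hi
    have hp := not_lt.1 fun h => hmem.1 ⟨t, ht, h⟩
    have hm := not_lt.1 fun h => hmem.2 ⟨t, ht, h⟩
    simp only [one_mul, neg_mul, Finset.sum_neg_distrib] at hp hm
    have e : ((t : ℝ) + 1) ^ (3 / 2 : ℝ) * lam =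
        3 * B / 2 * √ℓ * ((t : ℝ) + 1) ^ (3 / 2 : ℝ) := by rw [hlam, mul_comm]
    rw [abs_le, e]
    exact ⟨by linarith, hp⟩

/-- Outside an event of small probability, the excess loss of the average decays at rate `1 / t`. -/
lemma exists_excess_loss_event (hη : η = α / 2) (hreg : RegularLosses μ f T R S)
    (h1 : StatisticalSparsity μ f T L wstar R S k) (h2 : StronglyConvexOnSupport L α S)
    (h3 : BoundedGradients μ f T R S B) (h4 : OrthogonalNoise L R S)
    (hball : IteratesInBall μ f T R S η lam 0) (hB : 0 ≤ B) (hℓ : 1 ≤ ℓ)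
    (hlam : lam = 3 * B / 2 * √ℓ) :
    ∃ E : Set Ω,
      μ E ≤ ENNReal.ofReal ((2 * d + 1) * ((Nat.log 2 T + 1 : ℕ) * Real.exp (-ℓ))) ∧
      ∀ᵐ ω ∂μ, ω ∉ E → ∀ t ∈ Finset.Icc 1 T,
        (∀ i ∉ S, average η lam 0 (fun j => f j ω) t i = 0) ∧
        L (average η lam 0 (fun j => f j ω) t) - L wstar ≤ 90 * B ^ 2 * k * ℓ / (α * (t + 1)) := by
  have hα := h2.1
  have hlam0 : 0 ≤ lam := by rw [hlam]; positivity
  obtain ⟨E₁, hE₁, hmem⟩ := exists_support_event hreg h1 h3 h4 hball hB (by linarith) hlam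
  have hE₂ := measure_gradient_noise_le (η := η) (lam := lam) (ℓ := ℓ) hreg h1 h3 hB (by linarith)
    (γ := α / 8) (by linarith)
  set E₂ : Set Ω := {ω | ∃ t < T, α / 8 * ∑ s ∈ Finset.range (t + 1), ((s : ℝ) + 1) *
        ‖clippedIterate R S η lam (fun j => f j ω) s - wstar‖ ^ 2 +
          (2 * B * √k) ^ 2 * (t + 1) * ℓ / (α / 8) <
        ∑ s ∈ Finset.range (t + 1), ((s : ℝ) + 1) *
          inner ℝ (gradient L (clippedIterate R S η lam (fun j => f j ω) s) -
            gradient (f (s + 1) ω) (clippedIterate R S η lam (fun j => f j ω) s))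
            (clippedIterate R S η lam (fun j => f j ω) s - wstar)}
  refine ⟨E₁ ∪ E₂, ?_, ?_⟩
  · refine (measure_union_le _ _).trans ((add_le_add hE₁ hE₂).trans_eq ?_)
    rw [← ENNReal.ofReal_add (by positivity) (by positivity)]
    congr 1
    ring
  filter_upwards [hmem, h3] with ω hω hgrad hE t ht
  obtain ⟨hωE₁, hωE₂⟩ := not_or.1 hE
  have hcand := hω hωE₁
  obtain ⟨ht1, htT⟩ := Finset.mem_Icc.1 ht
  obtain ⟨n, rfl⟩ := Nat.exists_eq_add_of_le' ht1
  have hclip : ∀ s ∈ Finset.range (n + 1), clippedIterate R S η lam (fun j => f j ω) s =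
      iterate η lam 0 (fun j => f j ω) (s + 1) := fun s hs =>
    clippedIterate_of_mem (hcand s ((Finset.mem_range.1 hs).trans_le htT))
  have hzero : ∀ s < n + 1, ∀ i ∉ S, iterate η lam 0 (fun j => f j ω) (s + 1) i = 0 :=
    fun s hs i hi => apply_eq_zero_of_supp_subset (hcand s (hs.trans_le htT)).2 hi
  refine ⟨fun i hi => average_apply_eq_zero fun s hs => hzero s hs i hi, ?_⟩
  have hnoise := not_lt.1 fun h => hωE₂ ⟨n, htT, h⟩
  have hsum : ∀ H : ℕ → Vec d → ℝ,
      ∑ s ∈ Finset.range (n + 1), H s (clippedIterate R S η lam (fun j => f j ω) s) =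
        ∑ s ∈ Finset.range (n + 1), H s (iterate η lam 0 (fun j => f j ω) (s + 1)) := fun H =>
    Finset.sum_congr rfl fun s hs => by rw [hclip s hs]
  rw [hsum fun s w => ((s : ℝ) + 1) * inner ℝ (gradient L w - gradient (f (s + 1) ω) w) (w - wstar),
    hsum fun s w => ((s : ℝ) + 1) * ‖w - wstar‖ ^ 2] at hnoise
  have hdet := sum_excess_loss_le (f := fun j => f j ω) h2 hη hlam0 (B := B) h1.card_le
    (u := wstar) (fun i hi => apply_eq_zero_of_supp_subset h1.wstar_mem.2 hi) hzero
    (fun s hs => differentiableAt_loss hreg h1 ht (hcand s (hs.trans_le htT)))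
    (fun s hs i => hgrad (s + 1) (Finset.mem_Icc.2 ⟨by omega, by omega⟩) _
      (hcand s (hs.trans_le htT)) i)
  have havg := average_loss_le (η := η) (lam := lam) (ε := 0) (f := fun j => f j ω) h2.convexOn
    (L wstar) (n + 1)
  set V := L (average η lam 0 (fun j => f j ω) (n + 1)) - L wstar with hV
  have hk0 : (0 : ℝ) ≤ k := Nat.cast_nonneg k
  -- `81 / 8` from the penalty, `2 ≤ 2 ℓ` from stability and `32` from the noise stay below `45`
  have hconst : ((n + 1 : ℕ) : ℝ) * (k * ((9 * lam ^ 2 / 2 + 2 * B ^ 2) / α)) +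
      (2 * B * √k) ^ 2 * (n + 1) * ℓ / (α / 8) ≤
      ((n : ℝ) + 1) * (45 * B ^ 2 * k * ℓ / α) := by
    have e1 : lam ^ 2 = 9 / 4 * B ^ 2 * ℓ := by
      rw [hlam, mul_pow, Real.sq_sqrt (by linarith)]; ring
    have e2 : (2 * B * √k) ^ 2 = 4 * B ^ 2 * k := by
      rw [mul_pow, Real.sq_sqrt hk0]; ring
    rw [e1, e2]
    have e3 : ((n : ℝ) + 1) * (45 * B ^ 2 * k * ℓ / α) -
        (((n + 1 : ℕ) : ℝ) * (k * ((9 * (9 / 4 * B ^ 2 * ℓ) / 2 + 2 * B ^ 2) / α)) +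
        4 * B ^ 2 * k * (n + 1) * ℓ / (α / 8)) =
        ((n : ℝ) + 1) * k * B ^ 2 * (23 / 8 * ℓ - 2) / α := by
      push_cast; field_simp; ring
    have e4 : 0 ≤ ((n : ℝ) + 1) * k * B ^ 2 * (23 / 8 * ℓ - 2) / α := by
      have : 0 ≤ 23 / 8 * ℓ - 2 := by linarith
      positivity
    linarith
  have htotal : ((n : ℝ) + 1) * ((n + 2) / 2 * V) ≤ ((n : ℝ) + 1) * (45 * B ^ 2 * k * ℓ / α) := by
    push_cast at havg
    have e : ((n : ℝ) + 1) * ((n + 2) / 2 * V) = (n + 1) * (n + 1 + 1) / 2 * V := by ring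
    rw [e]
    linarith
  have hfinal := le_of_mul_le_mul_left htotal (by positivity)
  push_cast
  rw [le_div_iff₀ (by positivity)]
  rw [le_div_iff₀ hα] at hfinal
  linarith

end Rate

end StreamingSparse

theorem theorem5 {Ω : Type*} [MeasurableSpace Ω] (μ : Measure Ω) [IsProbabilityMeasure μ]
    (d k T : ℕ) (f : ℕ → Ω → StreamingSparse.Vec d → ℝ) (L : StreamingSparse.Vec d → ℝ)
    (wstar : StreamingSparse.Vec d) (S : Finset (Fin d)) (R B α δ η lam : ℝ)
    (hδ : 0 < δ)
    (hη : η = α / 2)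
    (hlam : lam = 3 * B / 2 * Real.sqrt (Real.log (2 * d * Real.logb 2 (2 * (T : ℝ) ^ 3) / δ)))
    (hreg : StreamingSparse.RegularLosses μ f T R S)
    (h1 : StreamingSparse.StatisticalSparsity μ f T L wstar R S k)
    (h2 : StreamingSparse.StronglyConvexOnSupport L α S)
    (h3 : StreamingSparse.BoundedGradients μ f T R S B)
    (h4 : StreamingSparse.OrthogonalNoise L R S)
    (hball : StreamingSparse.IteratesInBall μ f T R S η lam 0) :
    ENNReal.ofReal (1 - 3 * δ) ≤ μ {ω | ∀ t ∈ Finset.Icc 1 T,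
      L (StreamingSparse.average η lam 0 (fun j => f j ω) t) - L wstar
          ≤ 269 * B ^ 2 * k * Real.log (2 * d * Real.logb 2 (2 * (T : ℝ) ^ 3) / δ) / (α * t) ∧
        1 / 2 * ‖StreamingSparse.average η lam 0 (fun j => f j ω) t - wstar‖ ^ 2
          ≤ 269 * B ^ 2 * k * Real.log (2 * d * Real.logb 2 (2 * (T : ℝ) ^ 3) / δ)
              / (α ^ 2 * t)} := by
  -- in dimension zero there is a single weight vector
  rcases Nat.eq_zero_or_pos d with rfl | hd
  · refine le_of_le_of_eq (ENNReal.ofReal_le_one.2 (by linarith)) ?_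
    rw [← measure_univ (μ := μ)]
    congr 1
    refine (Set.eq_univ_of_forall fun ω t _ => ?_).symm
    rw [Subsingleton.elim (StreamingSparse.average η lam 0 (fun j => f j ω) t) wstar]
    simp
  rcases le_or_gt (1 / 3) δ with hδ3 | hδ3
  · rw [ENNReal.ofReal_of_nonpos (by linarith)]
    exact zero_le
  rcases Nat.eq_zero_or_pos T with rfl | hT
  · simp only [Finset.Icc_eq_empty_of_lt one_pos, Finset.notMem_empty, IsEmpty.forall_iff,
      implies_true]
    refine le_of_le_of_eq (ENNReal.ofReal_le_one.2 (by linarith)) ?_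
    simp
  have hα := h2.1
  set K : ℝ := Real.logb 2 (2 * (T : ℝ) ^ 3) with hK
  set ℓ : ℝ := Real.log (2 * d * K / δ) with hℓdef
  have hd1 : (1 : ℝ) ≤ d := by exact_mod_cast hd
  have hT1 : (1 : ℝ) ≤ T := by exact_mod_cast hT
  have hJK : ((Nat.log 2 T + 1 : ℕ) : ℝ) ≤ K := by
    have e : K = 1 + 3 * Real.logb 2 T := by
      rw [hK, Real.logb_mul two_ne_zero (by positivity), Real.logb_self_eq_one one_lt_two,
        Real.logb_pow]
      norm_num
    have h := Real.natLog_le_logb T 2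
    have h0 : (0 : ℝ) ≤ Real.logb 2 T := Real.logb_nonneg one_lt_two hT1
    push_cast at h ⊢
    linarith
  have hK1 : 1 ≤ K := le_trans (by push_cast; linarith [Nat.cast_nonneg (α := ℝ) (Nat.log 2 T)]) hJK
  have hdK : 1 ≤ d * K := one_le_mul_of_one_le_of_one_le hd1 hK1
  have hpos : 0 < 2 * d * K / δ := by
    rw [mul_assoc]; positivity
  have hℓ : 1 ≤ ℓ := by
    rw [hℓdef, Real.le_log_iff_exp_le hpos, le_div_iff₀ hδ]
    have := Real.exp_one_lt_three
    nlinarith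
  have hexp : Real.exp (-ℓ) = δ / (2 * d * K) := by
    rw [Real.exp_neg, hℓdef, Real.exp_log hpos, inv_div]
  have hB : 0 ≤ B := by
    obtain ⟨ω, hω⟩ := h3.exists
    exact (abs_nonneg _).trans
      (hω 1 (Finset.mem_Icc.2 ⟨le_rfl, hT⟩) wstar h1.wstar_mem ⟨0, hd⟩)
  obtain ⟨E, hE, hgood⟩ := StreamingSparse.exists_excess_loss_event hη hreg h1 h2 h3 h4 hball hB hℓ
    hlam
  have hprob : (2 * (d : ℝ) + 1) * ((Nat.log 2 T + 1 : ℕ) * Real.exp (-ℓ)) ≤ 3 * δ := by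
    rw [hexp]
    have hKpos : 0 < K := by linarith
    have h5 : ((Nat.log 2 T + 1 : ℕ) : ℝ) * (δ / (2 * d * K)) ≤ δ / (2 * d) := by
      calc _ ≤ K * (δ / (2 * d * K)) := mul_le_mul_of_nonneg_right hJK (by positivity)
        _ = _ := by field_simp
    calc _ ≤ (2 * (d : ℝ) + 1) * (δ / (2 * d)) := mul_le_mul_of_nonneg_left h5 (by positivity)
      _ ≤ _ := by
        rw [← mul_div_assoc, div_le_iff₀ (by positivity)]
        nlinarith
  set G : Set Ω := {ω | ∀ t ∈ Finset.Icc 1 T,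
      L (StreamingSparse.average η lam 0 (fun j => f j ω) t) - L wstar
          ≤ 269 * B ^ 2 * k * ℓ / (α * t) ∧
        1 / 2 * ‖StreamingSparse.average η lam 0 (fun j => f j ω) t - wstar‖ ^ 2
          ≤ 269 * B ^ 2 * k * ℓ / (α ^ 2 * t)} with hG
  have hsub : (Gᶜ : Set Ω) ≤ᵐ[μ] E := by
    filter_upwards [hgood] with ω hω hωG
    by_contra hωE
    refine hωG fun t ht => ?_
    obtain ⟨hzero, hexcess⟩ := hω hωE t ht
    have ht1 : (1 : ℝ) ≤ t := by exact_mod_cast (Finset.mem_Icc.1 ht).1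
    have hloss : L (StreamingSparse.average η lam 0 (fun j => f j ω) t) - L wstar
        ≤ 269 * B ^ 2 * k * ℓ / (α * t) := by
      refine hexcess.trans (div_le_div₀ (by positivity) ?_ (by positivity) ?_)
      · have h6 : 0 ≤ B ^ 2 * k * ℓ := by positivity
        linarith
      · exact mul_le_mul_of_nonneg_left (by linarith) hα.le
    refine ⟨hloss, ?_⟩
    -- the gradient vanishes at the minimizer, so strong convexity turns loss into distance
    have hgrad : gradient L wstar = 0 := by
      have hmin : IsLocalMin L wstar := Filter.Eventually.of_forall h1.minimizer
      rw [gradient, hmin.fderiv_eq_zero, map_zero]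
    have hstrong := h2.add_inner_le (StreamingSparse.differentiableAt_loss hreg h1 ht h1.wstar_mem)
      (StreamingSparse.average η lam 0 (fun j => f j ω) t)
    have hnorm : ∑ i ∈ S,
        (StreamingSparse.average η lam 0 (fun j => f j ω) t i - wstar i) ^ 2 =
        ‖StreamingSparse.average η lam 0 (fun j => f j ω) t - wstar‖ ^ 2 := by
      rw [StreamingSparse.norm_sq_eq_sum_of_supp (S := S) fun i hi => by
        rw [PiLp.sub_apply, hzero i hi,
          StreamingSparse.apply_eq_zero_of_supp_subset h1.wstar_mem.2 hi, sub_zero]]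
      rfl
    rw [hgrad, inner_zero_left, add_zero, hnorm] at hstrong
    have e : 269 * B ^ 2 * k * ℓ / (α ^ 2 * t) = 269 * B ^ 2 * k * ℓ / (α * t) / α := by
      field_simp
    rw [e, le_div_iff₀ hα]
    linarith
  have hGc : μ Gᶜ ≤ ENNReal.ofReal (3 * δ) :=
    (measure_mono_ae hsub).trans (hE.trans (ENNReal.ofReal_le_ofReal hprob))
  rw [ENNReal.ofReal_sub _ (by linarith), ENNReal.ofReal_one, tsub_le_iff_right]
  calc (1 : ENNReal) = μ (G ∪ Gᶜ) := by rw [Set.union_compl_self, measure_univ]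
    _ ≤ μ G + μ Gᶜ := measure_union_le _ _
    _ ≤ μ G + ENNReal.ofReal (3 * δ) := add_le_add le_rfl hGc
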